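/- There is a polynomial-time algorithm for the following problem. The input is a tournament $T=(V,E)$ (a directed graph without loops in which, for any two distinct nodes $u,v$, exactly one of $(u,v)$, $(v,u)$ is an edge; $(u,v)\in E$ means that team $u$ beats team $v$), a set $M\subseteq E$ of manipulable edges, and a distinguished node $v_w\in V$. The output is the minimal number of edges in $M$ that can be reversed (replacing $(u,v)$ by $(v,u)$) such that in the resulting tournament $\mathrm{outDegree}(v_w)\ge \mathrm{outDegree}(v_k)$ for every $v_k\in V$ with $v_k\ne v_w$, i.e. such that $v_w$ has the maximum Copeland (win–loss) score; if no set of reversals of edges in $M$ achieves this, the algorithm reports so. Precisely: there are a single program for a random access machine (registers and indirectly addressed memory holding natural numbers; assignment, load, store, addition, truncated subtraction and tests for zero, at unit cost) and a polynomial $p$ such that on every input with $|V|=n$, given by $n$, the index of $v_w$ and the $n\times n$ adjacency matrices of $E$ and $M$, the program halts after at most $p(n)$ steps with the correct output. -/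

import Mathlib

/-! ## Tournaments and manipulations -/

/-- A tournament on `V`, given by its set `E` of directed edges: there are no loops, and for any two
distinct teams `u`, `v` exactly one of `(u, v)`, `(v, u)` is an edge. The edge `(u, v)` says that
`u` beats `v`. -/
def IsTournament {V : Type*} (E : Finset (V × V)) : Prop :=
  (∀ v, (v, v) ∉ E) ∧ ∀ u v, u ≠ v → ((u, v) ∈ E ↔ (v, u) ∉ E)

/-- The out-degree of `v`, i.e. its number of wins (its Copeland score). -/
def outDegree {V : Type*} [DecidableEq V] (E : Finset (V × V)) (v : V) : ℕ :=
  (E.filter fun e => e.1 = v).card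

/-- The edge set obtained from `E` by reversing the edges in `R`. -/
def reverseEdges {V : Type*} [DecidableEq V] (E R : Finset (V × V)) : Finset (V × V) :=
  (E \ R) ∪ R.image Prod.swap

/-- `w` is a winner under Copeland scoring: no other team has a larger out-degree. -/
def IsCopelandWinner {V : Type*} [DecidableEq V] (E : Finset (V × V)) (w : V) : Prop :=
  ∀ v, v ≠ w → outDegree E v ≤ outDegree E w

/-- The numbers `k` such that reversing some `k` of the manipulable edges `M` makes `w` a winner. -/
def manipulationCounts {V : Type*} [DecidableEq V] (E M : Finset (V × V)) (w : V) : Set ℕ :=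
  {k | ∃ R, R ⊆ M ∧ R.card = k ∧ IsCopelandWinner (reverseEdges E R) w}

/-! ## Random access machines

A (unit-cost) random access machine with registers and an indirectly addressed memory, all
holding natural numbers. The arithmetic instructions are addition and truncated subtraction only;
since there is no multiplication, a number handled within `t` steps has at most `t` more bits than
the numbers of the input and of the program, so that polynomial time on this machine is the same
as polynomial time on a Turing machine. -/

namespace RAM

/-- A state of the machine: the contents of the registers and of the memory. -/
@[ext]
structure State where
  /-- contents of the registers -/
  reg : ℕ → ℕ
  /-- contents of the memory cells -/
  mem : ℕ → ℕ

/-- `s.setReg x a` is `s` with register `x` overwritten by `a`. -/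
def State.setReg (s : State) (x a : ℕ) : State :=
  { s with reg := Function.update s.reg x a }

/-- `s.setMem i a` is `s` with memory cell `i` overwritten by `a`. -/
def State.setMem (s : State) (i a : ℕ) : State :=
  { s with mem := Function.update s.mem i a }

/-- Programs, in structured form. The arguments `x`, `y`, `z` are names of registers. -/
inductive Program where
  /-- `x := a` -/
  | const (x a : ℕ)
  /-- `x := y` -/
  | copy (x y : ℕ)
  /-- `x := y + z` -/
  | add (x y z : ℕ)
  /-- `x := y - z`, truncated at `0` -/
  | sub (x y z : ℕ)
  /-- `x := mem[y]` -/
  | load (x y : ℕ)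
  /-- `mem[x] := y` -/
  | store (x y : ℕ)
  /-- do nothing -/
  | skip
  /-- first `p`, then `q` -/
  | seq (p q : Program)
  /-- if `x ≠ 0` then `p` else `q` -/
  | cond (x : ℕ) (p q : Program)
  /-- while `x ≠ 0` do `p` -/
  | loop (x : ℕ) (p : Program)

/-- `Exec p s s' t`: started in state `s`, the program `p` halts in state `s'` after exactly `t`
steps. A step is one elementary instruction or one test of a register. -/
inductive Exec : Program → State → State → ℕ → Prop where
  | const (x a : ℕ) (s : State) : Exec (.const x a) s (s.setReg x a) 1
  | copy (x y : ℕ) (s : State) : Exec (.copy x y) s (s.setReg x (s.reg y)) 1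
  | add (x y z : ℕ) (s : State) : Exec (.add x y z) s (s.setReg x (s.reg y + s.reg z)) 1
  | sub (x y z : ℕ) (s : State) : Exec (.sub x y z) s (s.setReg x (s.reg y - s.reg z)) 1
  | load (x y : ℕ) (s : State) : Exec (.load x y) s (s.setReg x (s.mem (s.reg y))) 1
  | store (x y : ℕ) (s : State) : Exec (.store x y) s (s.setMem (s.reg x) (s.reg y)) 1
  | skip (s : State) : Exec .skip s s 1
  | seq {p q : Program} {s s' s'' : State} {t t' : ℕ} :
      Exec p s s' t → Exec q s' s'' t' → Exec (.seq p q) s s'' (t + t')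
  | cond_ne {x : ℕ} {p q : Program} {s s' : State} {t : ℕ} :
      s.reg x ≠ 0 → Exec p s s' t → Exec (.cond x p q) s s' (t + 1)
  | cond_eq {x : ℕ} {p q : Program} {s s' : State} {t : ℕ} :
      s.reg x = 0 → Exec q s s' t → Exec (.cond x p q) s s' (t + 1)
  | loop_ne {x : ℕ} {p : Program} {s s' s'' : State} {t t' : ℕ} :
      s.reg x ≠ 0 → Exec p s s' t → Exec (.loop x p) s' s'' t' →
        Exec (.loop x p) s s'' (t + t' + 1)
  | loop_eq {x : ℕ} {p : Program} {s : State} :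
      s.reg x = 0 → Exec (.loop x p) s s 1

/-- The machine is deterministic: the program and the initial state determine the final state and
the number of steps. -/
theorem Exec.deterministic {p : Program} {s s₁ s₂ : State} {t₁ t₂ : ℕ}
    (h₁ : Exec p s s₁ t₁) (h₂ : Exec p s s₂ t₂) : s₁ = s₂ ∧ t₁ = t₂ := by
  induction h₁ generalizing s₂ t₂ with
  | seq _ _ ih₁ ih₂ =>
    cases h₂ with
    | seq a b =>
      obtain ⟨rfl, rfl⟩ := ih₁ a
      obtain ⟨rfl, rfl⟩ := ih₂ b
      exact ⟨rfl, rfl⟩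
  | cond_ne hx _ ih =>
    cases h₂ with
    | cond_ne _ a =>
      obtain ⟨rfl, rfl⟩ := ih a
      exact ⟨rfl, rfl⟩
    | cond_eq hx' _ => exact absurd hx' hx
  | cond_eq hx _ ih =>
    cases h₂ with
    | cond_ne hx' _ => exact absurd hx hx'
    | cond_eq _ a =>
      obtain ⟨rfl, rfl⟩ := ih a
      exact ⟨rfl, rfl⟩
  | loop_ne hx _ _ ih₁ ih₂ =>
    cases h₂ with
    | loop_ne _ a b =>
      obtain ⟨rfl, rfl⟩ := ih₁ a
      obtain ⟨rfl, rfl⟩ := ih₂ b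
      exact ⟨rfl, rfl⟩
    | loop_eq hx' => exact absurd hx' hx
  | loop_eq hx =>
    cases h₂ with
    | loop_ne hx' _ _ => exact absurd hx hx'
    | loop_eq _ => exact ⟨rfl, rfl⟩
  | _ => cases h₂; exact ⟨rfl, rfl⟩

end RAM

/-! ## Input and output of the algorithm -/

/-- The `0`-`1` adjacency matrix of `E`, written row by row: position `i * n + j` holds `1` if
`(i, j) ∈ E`; all other positions hold `0`. -/
def adjacencyCell {n : ℕ} (E : Finset (Fin n × Fin n)) (a : ℕ) : ℕ :=
  if ∃ e ∈ E, a = (e.1 : ℕ) * n + (e.2 : ℕ) then 1 else 0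

/-- The initial state for an instance: the number `n` of teams is in register `0`, the distinguished
team `w` in register `1`, the adjacency matrix of `E` in the memory cells `0, …, n * n - 1` and that
of `M` in the cells `n * n, …, 2 * (n * n) - 1`. Everything else is `0`. -/
def inputState {n : ℕ} (E M : Finset (Fin n × Fin n)) (w : Fin n) : RAM.State where
  reg x := if x = 0 then n else if x = 1 then (w : ℕ) else 0
  mem a := if a < n * n then adjacencyCell E a else adjacencyCell M (a - n * n)

/-- The final state `s` reports the minimum of the set `S` of numbers: either register `0` holds `1`
and register `1` the minimum of `S`, or `S` is empty and register `0` holds `0`. -/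
def ReportsMin (s : RAM.State) (S : Set ℕ) : Prop :=
  (s.reg 0 = 1 ∧ IsLeast S (s.reg 1)) ∨ (s.reg 0 = 0 ∧ S = ∅)

/-! The problem reduces to `n + 1` assignment problems with `N = n * n` persons and slots. Fix a
target score `D`. Persons are all pairs of teams, the edges among them being games; slots are pairs
`(v, k)`, read as the `k`-th possible win of `v`. Sending a game to a slot of its original winner
costs 0, and to one of its original loser 1 if the edge is manipulable. Every `v ≠ w` may take games
only in its first `D` slots, while the first `D` slots of `w` must be filled by games, so an
admissible assignment gives every rival at most `D` wins and `w` at least `D`. Its cost is the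
number of reversals. Conversely, a successful manipulation gives an assignment of the same cost when
`D` is the resulting score of `w` (`exists_totalCost_eq`, `totalCost_mem`). Forbidden placements
cost `N + 1`, more than any number of reversals, so the minimum over `D ≤ n` decides the instance
(`isLeast_or_eq_empty`).

Each assignment problem is solved by an auction with increment 1. An unplaced person takes the slot
minimising cost plus price, raises its price by 1 and evicts the owner. Every owner stays within 1
of its best choice (`Auction.bid`), so the final assignment is optimal up to `N` (`Auction.finish`).
All costs are multiplied by `N + 1`, which makes this error too small to matter. While someone is
unplaced, some slot is free and has price 0; this keeps the prices bounded by the largest cost plus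
1, so the number of bids is polynomial (`Auction.price_le`, `Auction.potential_bid_lt`).

On the machine, loop-free code is evaluated symbolically (`exec_eval`), and loops are handled by an
invariant with a decreasing measure (`Halts.loop`) or a counter (`Halts.loop_count`). -/

/-! ## The auction algorithm for the assignment problem -/

/-- The invariant of the auction for the cost matrix `C`, whose entries are at most `L`. The persons
below `m` have entered; all of them own a slot, except for `cur`; `p j` is the price of the slot `j`
and `o j` its owner. -/
structure Auction {N : ℕ} (C : Fin N → Fin N → ℕ) (L m : ℕ) (cur : Option (Fin N))
    (p : Fin N → ℕ) (o : Fin N → Option (Fin N)) : Prop where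
  free : ∀ j, o j = none → p j = 0
  slack : ∀ i j, o j = some i → ∀ j', C i j + p j ≤ C i j' + p j' + 1
  inj : ∀ i j j', o j = some i → o j' = some i → j = j'
  fresh : ∀ i j, cur = some i → o j ≠ some i
  below : ∀ i j, o j = some i → (i : ℕ) < m
  cur_below : ∀ i, cur = some i → (i : ℕ) < m
  cover : ∀ i : Fin N, (i : ℕ) < m → cur = some i ∨ ∃ j, o j = some i
  bound : ∀ j, p j ≤ L + 1

namespace Auction

variable {N : ℕ} {C : Fin N → Fin N → ℕ} {L m : ℕ} {cur : Option (Fin N)}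
  {p : Fin N → ℕ} {o : Fin N → Option (Fin N)}

theorem start : Auction C L 0 none (fun _ => 0) (fun _ => none) := by
  constructor <;> simp

theorem enter (h : Auction C L m none p o) (hm : m < N) :
    Auction C L (m + 1) (some ⟨m, hm⟩) p o where
  free := h.free
  slack := h.slack
  inj := h.inj
  fresh i j hi hj := by
    have := h.below i j hj
    simp only [Option.some.injEq] at hi
    subst hi
    exact lt_irrefl _ this
  below i j hj := (h.below i j hj).trans (Nat.lt_succ_self m)
  cur_below i hi := by
    simp only [Option.some.injEq] at hi
    subst hi
    exact Nat.lt_succ_self m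
  cover i hi := by
    rcases Nat.lt_succ_iff_lt_or_eq.1 hi with hi | hi
    · exact Or.inr ((h.cover i hi).resolve_left (by simp))
    · exact Or.inl (congrArg some (Fin.ext hi.symm))
  bound := h.bound

/-- Pigeonhole: if all `N` slots were owned, the injective owner map would be onto, and the unplaced
person would own one. -/
theorem exists_free {i : Fin N} (h : Auction C L m (some i) p o) : ∃ j, o j = none := by
  by_contra! hn
  choose f hf using fun j => Option.ne_none_iff_exists'.1 (hn j)
  have hinj : Function.Injective f := fun j j' hjj =>
    h.inj (f j) j j' (hf j) (by rw [hjj]; exact hf j')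
  obtain ⟨j, hj⟩ := (Finite.injective_iff_surjective.1 hinj) i
  exact h.fresh i j rfl (by rw [hf, hj])

/-- A free slot has price 0, so it offers a total of at most `L`, and the best slot cannot be
dearer. -/
theorem price_le {i j : Fin N} (h : Auction C L m (some i) p o) (hC : ∀ i j, C i j ≤ L)
    (hj : ∀ j', C i j + p j ≤ C i j' + p j') : p j ≤ L := by
  obtain ⟨j₀, h₀⟩ := h.exists_free
  have h₁ := hj j₀
  rw [h.free j₀ h₀] at h₁
  have := hC i j₀
  omega

/-- Raising one price only makes the alternatives of the other owners less attractive, and the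
bidder had a best slot before paying 1 more, so the slack of 1 survives. The former owner, if any,
becomes the unplaced person. -/
theorem bid {i j : Fin N} (h : Auction C L m (some i) p o) (hC : ∀ i j, C i j ≤ L)
    (hj : ∀ j', C i j + p j ≤ C i j' + p j') :
    Auction C L m (o j) (Function.update p j (p j + 1)) (Function.update o j (some i)) where
  free j' hj' := by
    rcases eq_or_ne j' j with rfl | hne
    · simp at hj'
    · rw [Function.update_of_ne hne] at hj' ⊢
      exact h.free j' hj'
  slack i' k hk k' := by
    have hp : p k' ≤ Function.update p j (p j + 1) k' := by
      rcases eq_or_ne k' j with rfl | hne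
      · simp
      · rw [Function.update_of_ne hne]
    rcases eq_or_ne k j with rfl | hne
    · simp only [Function.update_self, Option.some.injEq] at hk ⊢
      subst hk
      have := hj k'
      omega
    · rw [Function.update_of_ne hne] at hk ⊢
      have := h.slack i' k hk k'
      omega
  inj i' k k' hk hk' := by
    by_cases hkj : k = j <;> by_cases hkj' : k' = j <;>
      simp only [Function.update_apply, hkj, hkj', if_true, if_false, Option.some.injEq] at hk hk' ⊢
    · subst hk
      exact absurd hk' (h.fresh i k' rfl)
    · subst hk'
      exact absurd hk (h.fresh i k rfl)
    · exact h.inj i' k k' hk hk'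
  fresh i' k hi' hk := by
    by_cases hkj : k = j <;>
      simp only [Function.update_apply, hkj, if_true, if_false, Option.some.injEq] at hk
    · subst hk
      exact h.fresh i j rfl hi'
    · exact hkj (h.inj i' k j hk hi')
  below i' k hk := by
    by_cases hkj : k = j <;>
      simp only [Function.update_apply, hkj, if_true, if_false, Option.some.injEq] at hk
    · subst hk
      exact h.cur_below i rfl
    · exact h.below i' k hk
  cur_below i' hi' := h.below i' j hi'
  cover i' hi' := by
    rcases h.cover i' hi' with hc | ⟨k, hk⟩
    · exact Or.inr ⟨j, by rw [Function.update_self]; exact hc⟩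
    · rcases eq_or_ne k j with rfl | hne
      · exact Or.inl hk
      · exact Or.inr ⟨k, by rw [Function.update_of_ne hne]; exact hk⟩
  bound k := by
    rcases eq_or_ne k j with rfl | hne
    · rw [Function.update_self]
      exact Nat.succ_le_succ (h.price_le hC hj)
    · rw [Function.update_of_ne hne]
      exact h.bound k

/-- The amount by which the prices can still rise. -/
def potential (L : ℕ) (p : Fin N → ℕ) : ℕ := ∑ j, (L + 1 - p j)

theorem potential_le (L : ℕ) (p : Fin N → ℕ) : potential L p ≤ N * (L + 1) := by
  refine (Finset.sum_le_card_nsmul Finset.univ _ (L + 1) fun j _ => Nat.sub_le _ _).trans ?_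
  simp

theorem potential_bid_lt {L : ℕ} {p : Fin N → ℕ} {j : Fin N} (hj : p j ≤ L) :
    potential L (Function.update p j (p j + 1)) < potential L p := by
  refine Finset.sum_lt_sum (fun k _ => ?_) ⟨j, Finset.mem_univ j, ?_⟩
  · rcases eq_or_ne k j with rfl | hne
    · rw [Function.update_self]
      omega
    · rw [Function.update_of_ne hne]
  · rw [Function.update_self]
    omega

/-- When everybody owns a slot, the assignment is optimal up to the number of persons. -/
theorem finish (h : Auction C L N none p o) :
    ∃ σ : Equiv.Perm (Fin N), (∀ j, o j = some (σ j)) ∧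
      ∀ τ : Equiv.Perm (Fin N), ∑ j, C (σ j) j ≤ ∑ j, C (τ j) j + N := by
  choose f hf using fun i : Fin N => (h.cover i i.2).resolve_left (by simp)
  have hinj : Function.Injective f := fun i i' hi => by
    have h₁ := hf i
    rw [hi, hf i'] at h₁
    exact (Option.some.inj h₁).symm
  let e : Equiv.Perm (Fin N) := Equiv.ofBijective f (Finite.injective_iff_bijective.1 hinj)
  have he : ∀ i, o (e i) = some i := hf
  refine ⟨e.symm, fun j => by rw [← he, e.apply_symm_apply], fun τ => ?_⟩
  -- Summed over all persons, the prices cancel, because both assignments use every slot exactly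
  -- once; only the `N` slacks of 1 remain.
  have key : ∀ i, C i (e i) + p (e i) ≤ C i (τ.symm i) + p (τ.symm i) + 1 := fun i =>
    h.slack i (e i) (he i) _
  have hsum := Finset.sum_le_sum fun i (_ : i ∈ Finset.univ) => key i
  simp only [Finset.sum_add_distrib, Finset.sum_const, Finset.card_univ, Fintype.card_fin,
    smul_eq_mul, mul_one, Equiv.sum_comp e p, Equiv.sum_comp τ.symm p] at hsum
  have h₁ : ∑ j, C (e.symm j) j = ∑ i, C i (e i) := by
    rw [← Equiv.sum_comp e]
    simp
  have h₂ : ∑ j, C (τ j) j = ∑ i, C i (τ.symm i) := by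
    rw [← Equiv.sum_comp τ.symm]
    simp
  omega

end Auction

/-! ## Manipulation as an assignment problem -/

section Reduction

variable {n : ℕ} {E M R : Finset (Fin n × Fin n)} {w : Fin n}

/-- The cost of assigning the pair `x` to the slot `y`, where the target score is `D`. The slot
`(v, k)` is the `k`-th possible win of `v`. An edge is a game and has to go to a slot of its winner;
among the slots of `v ≠ w`, only the first `D` are open to games, and the first `D` slots of `w` are
open to games only. The cost `n * n + 1` stands for a forbidden assignment. -/
def gameCost (E M : Finset (Fin n × Fin n)) (w : Fin n) (D : ℕ) (x y : Fin n × Fin n) : ℕ :=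
  if x ∈ E then
    (if y.1 = x.1 then 0 else if y.1 = x.2 ∧ x ∈ M then 1 else n * n + 1) +
      (if y.1 ≠ w ∧ D ≤ (y.2 : ℕ) then n * n + 1 else 0)
  else if y.1 = w ∧ (y.2 : ℕ) < D then n * n + 1 else 0

theorem gameCost_le (D : ℕ) (x y : Fin n × Fin n) :
    gameCost E M w D x y ≤ 2 * (n * n + 1) := by
  unfold gameCost
  split_ifs <;> omega

/-- The total cost of an assignment of all pairs to the slots. -/
def totalCost (E M : Finset (Fin n × Fin n)) (w : Fin n) (D : ℕ)
    (τ : Equiv.Perm (Fin n × Fin n)) : ℕ :=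
  ∑ y, gameCost E M w D (τ y) y

/-- The winner of the game `x` when the edges in `R` are reversed. -/
def gameWinner (R : Finset (Fin n × Fin n)) (x : Fin n × Fin n) : Fin n :=
  if x ∈ R then x.2 else x.1

/-- In a tournament the reverse of an edge is not an edge, so reversing never merges two edges and
wins can be counted over the original games. -/
theorem outDegree_reverseEdges (hE : IsTournament E) (hR : R ⊆ E) (v : Fin n) :
    outDegree (reverseEdges E R) v = (E.filter fun x => gameWinner R x = v).card := by
  have himg : reverseEdges E R = E.image fun x => if x ∈ R then x.swap else x := by
    ext x
    simp only [reverseEdges, Finset.mem_union, Finset.mem_sdiff, Finset.mem_image]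
    constructor
    · rintro (⟨hx, hxR⟩ | ⟨y, hy, rfl⟩)
      · exact ⟨x, hx, if_neg hxR⟩
      · exact ⟨y, hR hy, if_pos hy⟩
    · rintro ⟨y, hy, rfl⟩
      by_cases hyR : y ∈ R
      · exact Or.inr ⟨y, hyR, by rw [if_pos hyR]⟩
      · exact Or.inl (by rw [if_neg hyR]; exact ⟨hy, hyR⟩)
  have hswap : ∀ x ∈ E, x.swap ∉ E := by
    rintro ⟨a, b⟩ hx hx'
    rcases eq_or_ne a b with rfl | hab
    · exact hE.1 a hx
    · exact (hE.2 a b hab).1 hx hx'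
  rw [outDegree, himg, Finset.filter_image, Finset.card_image_of_injOn]
  · congr 1
    refine Finset.filter_congr fun x _ => ?_
    unfold gameWinner
    split_ifs <;> rfl
  · intro x hx y hy hxy
    have hx := (Finset.mem_filter.1 hx).1
    have hy := (Finset.mem_filter.1 hy).1
    dsimp only at hxy
    split_ifs at hxy with h₁ h₂ h₂
    · exact Prod.swap_injective hxy
    · exact absurd (hxy ▸ hy) (hswap x hx)
    · exact absurd (hxy ▸ hx) (hswap y hy)
    · exact hxy

/-- Take for `D` the new score of `w`, and number the games won by each team. This is a bijection
from the games to the slots `(v, k)` with `k` below the new score of `v`; any extension to a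
permutation sends the non-games to the remaining slots. -/
theorem exists_totalCost_eq (hE : IsTournament E) (hM : M ⊆ E) (hR : R ⊆ M)
    (hw : IsCopelandWinner (reverseEdges E R) w) :
    ∃ D ≤ n, ∃ τ : Equiv.Perm (Fin n × Fin n), totalCost E M w D τ = R.card := by
  classical
  let F : Fin n → Finset (Fin n × Fin n) := fun v => E.filter fun x => gameWinner R x = v
  have hdeg : ∀ v, outDegree (reverseEdges E R) v = (F v).card :=
    outDegree_reverseEdges hE (hR.trans hM)
  -- Games won by the same team have different losers.
  have hF : ∀ v, (F v).card ≤ n := fun v => by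
    rw [← hdeg, outDegree]
    calc _ ≤ (Finset.univ : Finset (Fin n)).card := by
            refine Finset.card_le_card_of_injOn Prod.snd (fun _ _ => Finset.mem_univ _) ?_
            intro x hx y hy hxy
            exact Prod.ext ((Finset.mem_filter.1 hx).2.trans (Finset.mem_filter.1 hy).2.symm) hxy
      _ = n := by simp
  have hmem : ∀ x : {x // x ∈ E}, x.1 ∈ F (gameWinner R x) := fun x =>
    Finset.mem_filter.2 ⟨x.2, rfl⟩
  let f : {x // x ∈ E} → {y : Fin n × Fin n // (y.2 : ℕ) < (F y.1).card} := fun x =>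
    ⟨(gameWinner R x, Fin.castLE (hF _) ((F (gameWinner R x)).equivFin ⟨x, hmem x⟩)), by
      exact ((F (gameWinner R x)).equivFin ⟨x, hmem x⟩).is_lt⟩
  -- The equality `v = v'` is a separate hypothesis because the types of `x` and `x'` depend on the
  -- teams.
  have hinj : ∀ (v v' : Fin n) (x : {x // x ∈ F v}) (x' : {x // x ∈ F v'}), v = v' →
      (((F v).equivFin x : Fin _) : ℕ) = ((F v').equivFin x' : Fin _) → x.1 = x'.1 := by
    rintro v _ x x' rfl h
    rw [(F v).equivFin.injective (Fin.ext h)]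
  have hbij : Function.Bijective f := by
    constructor
    · intro x x' h
      have h₁ := congrArg (fun y => y.1.1) h
      have h₂ := congrArg (fun y => (y.1.2 : ℕ)) h
      exact Subtype.ext (hinj _ _ ⟨x, hmem x⟩ ⟨x', hmem x'⟩ h₁ h₂)
    · rintro ⟨⟨v, k⟩, hk⟩
      set x := (F v).equivFin.symm ⟨k, hk⟩ with hx
      have hxF := Finset.mem_filter.1 x.2
      refine ⟨⟨x.1, hxF.1⟩, Subtype.ext (Prod.ext hxF.2 (Fin.ext ?_))⟩
      have : ∀ (v' : Fin n) (h : x.1 ∈ F v'), v' = v →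
          (((F v').equivFin ⟨x.1, h⟩ : Fin _) : ℕ) = k := by
        rintro _ h rfl
        simp [hx]
      exact this _ _ hxF.2
  let e := Equiv.ofBijective f hbij
  let ρ : Equiv.Perm (Fin n × Fin n) := e.extendSubtype
  have hρ : ∀ x (hx : x ∈ E), ρ x = (f ⟨x, hx⟩).1 := fun x hx =>
    e.extendSubtype_apply_of_mem x hx
  have hρ' : ∀ x, x ∉ E → (F (ρ x).1).card ≤ ((ρ x).2 : ℕ) := fun x hx =>
    not_lt.1 (e.extendSubtype_not_mem x hx)
  refine ⟨(F w).card, hF w, ρ.symm, ?_⟩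
  have hcost : ∀ x, gameCost E M w (F w).card x (ρ x) = if x ∈ R then 1 else 0 := by
    intro x
    by_cases hx : x ∈ E
    · have hlt := (f ⟨x, hx⟩).2
      rw [← hρ x hx] at hlt
      have hfst : (ρ x).1 = gameWinner R x := by rw [hρ x hx]
      have hle : (ρ x).1 ≠ w → (F (ρ x).1).card ≤ (F w).card := fun h => by
        rw [← hdeg, ← hdeg]
        exact hw _ h
      have hno : ¬ ((ρ x).1 ≠ w ∧ (F w).card ≤ ((ρ x).2 : ℕ)) := fun ⟨h₁, h₂⟩ =>
        absurd (hle h₁) (by omega)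
      -- Since there are no loops, a reversed game misses the cost-0 branch and costs exactly 1.
      have hne : x.1 ≠ x.2 := fun h => hE.1 x.1 (by
        have : x = (x.1, x.1) := Prod.ext rfl h.symm
        rwa [this] at hx)
      rw [gameCost, if_pos hx, if_neg hno, hfst, gameWinner]
      by_cases hxR : x ∈ R
      · rw [if_pos hxR, if_neg hne.symm, if_pos ⟨rfl, hR hxR⟩, if_pos hxR]
      · rw [if_neg hxR, if_pos rfl, if_neg hxR]
    · have hge := hρ' x hx
      have hno : ¬ ((ρ x).1 = w ∧ ((ρ x).2 : ℕ) < (F w).card) := fun ⟨h₁, h₂⟩ => by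
        rw [h₁] at hge
        omega
      rw [gameCost, if_neg hx, if_neg hno, if_neg fun h => hx (hM (hR h))]
  rw [totalCost, ← Equiv.sum_comp ρ]
  simp [hcost]

/-- A total below `n * n + 1` excludes every forbidden placement. The reversed edges are the games
placed in a slot of their loser, and counting slots compares both scores with `D`. -/
theorem totalCost_mem {D : ℕ} (hE : IsTournament E) (hM : M ⊆ E) (hD : D ≤ n)
    {τ : Equiv.Perm (Fin n × Fin n)} (hτ : totalCost E M w D τ < n * n + 1) :
    totalCost E M w D τ ∈ manipulationCounts E M w := by
  classical
  have hlt : ∀ y, gameCost E M w D (τ y) y < n * n + 1 := fun y =>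
    lt_of_le_of_lt (Finset.single_le_sum (f := fun y => gameCost E M w D (τ y) y)
      (fun _ _ => Nat.zero_le _) (Finset.mem_univ y)) hτ
  have hlt' : ∀ x, gameCost E M w D x (τ.symm x) < n * n + 1 := fun x => by
    simpa using hlt (τ.symm x)
  let R := E.filter fun x => (τ.symm x).1 ≠ x.1
  have hgame : ∀ x ∈ E, ((τ.symm x).1 = x.1 ∨ (τ.symm x).1 = x.2 ∧ x ∈ M) ∧
      ((τ.symm x).1 ≠ w → ((τ.symm x).2 : ℕ) < D) := by
    intro x hx
    have h := hlt' x
    rw [gameCost, if_pos hx] at h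
    constructor
    · by_contra! hc
      rw [if_neg hc.1, if_neg fun h => hc.2 h.1 h.2] at h
      omega
    · intro hne
      by_contra! hc
      rw [if_pos (⟨hne, hc⟩ : _ ∧ _)] at h
      omega
  have hfree : ∀ y, τ y ∉ E → ¬ (y.1 = w ∧ (y.2 : ℕ) < D) := by
    intro y hy hc
    have h := hlt y
    rw [gameCost, if_neg hy, if_pos hc] at h
    omega
  have hRM : R ⊆ M := fun x hx => by
    obtain ⟨hxE, hne⟩ := Finset.mem_filter.1 hx
    exact ((hgame x hxE).1.resolve_left hne).2
  have hwin : ∀ x ∈ E, gameWinner R x = (τ.symm x).1 := fun x hx => by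
    by_cases h : (τ.symm x).1 = x.1
    · have hxR : x ∉ R := fun hxR => (Finset.mem_filter.1 hxR).2 h
      rw [gameWinner, if_neg hxR, h]
    · rw [gameWinner, if_pos (Finset.mem_filter.2 ⟨hx, h⟩), ((hgame x hx).1.resolve_left h).1]
  refine ⟨R, hRM, ?_, ?_⟩
  · have hcost : ∀ x, gameCost E M w D x (τ.symm x) = if x ∈ R then 1 else 0 := by
      intro x
      by_cases hx : x ∈ E
      · obtain ⟨h₁, h₂⟩ := hgame x hx
        have hno : ¬ ((τ.symm x).1 ≠ w ∧ D ≤ ((τ.symm x).2 : ℕ)) := fun h =>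
          absurd (h₂ h.1) (not_lt.2 h.2)
        rw [gameCost, if_pos hx, if_neg hno]
        by_cases h : (τ.symm x).1 = x.1
        · have hxR : x ∉ R := fun hxR => (Finset.mem_filter.1 hxR).2 h
          rw [if_pos h, if_neg hxR]
        · rw [if_neg h, if_pos (h₁.resolve_left h), if_pos (Finset.mem_filter.2 ⟨hx, h⟩)]
      · rw [gameCost, if_neg hx, if_neg (hfree _ (by simpa using hx)),
          if_neg fun hxR => hx (Finset.mem_filter.1 hxR).1]
    rw [totalCost, ← Equiv.sum_comp τ.symm]
    simp [hcost]
  · intro v hv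
    rw [outDegree_reverseEdges hE (hRM.trans hM), outDegree_reverseEdges hE (hRM.trans hM)]
    -- The wins of `v` occupy distinct slots with index below `D`, while the first `D` slots of `w`
    -- hold distinct games won by `w`.
    calc _ ≤ (Finset.range D).card := by
            refine Finset.card_le_card_of_injOn (fun x => ((τ.symm x).2 : ℕ)) ?_ ?_
            · intro x hx
              obtain ⟨hxE, hxv⟩ := Finset.mem_filter.1 hx
              refine Finset.mem_coe.2 (Finset.mem_range.2 ((hgame x hxE).2 ?_))
              rwa [← hwin x hxE, hxv]
            · intro x hx x' hx' h
              obtain ⟨hxE, hxv⟩ := Finset.mem_filter.1 hx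
              obtain ⟨hxE', hxv'⟩ := Finset.mem_filter.1 hx'
              rw [hwin x hxE] at hxv
              rw [hwin x' hxE'] at hxv'
              exact τ.symm.injective (Prod.ext (hxv.trans hxv'.symm) (Fin.ext h))
      _ = (Finset.univ : Finset (Fin D)).card := by simp
      _ ≤ _ := by
            refine Finset.card_le_card_of_injOn (fun k => τ (w, Fin.castLE hD k)) ?_ ?_
            · intro k _
              have hk : τ (w, Fin.castLE hD k) ∈ E := by
                by_contra h
                exact hfree _ h ⟨rfl, k.2⟩
              refine Finset.mem_coe.2 (Finset.mem_filter.2 ⟨hk, ?_⟩)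
              rw [hwin _ hk]
              simp
            · intro k _ k' _ h
              have := τ.injective h
              simpa using this

/-- The cheapest assignment over all target scores yields the minimal number of reversals. -/
theorem isLeast_or_eq_empty {r : ℕ} (hE : IsTournament E) (hM : M ⊆ E)
    (hle : ∀ D ≤ n, ∀ τ, r ≤ totalCost E M w D τ)
    (hex : r = n * n + 1 ∨ ∃ D ≤ n, ∃ τ, r = totalCost E M w D τ) :
    (r < n * n + 1 → IsLeast (manipulationCounts E M w) r) ∧
      (n * n + 1 ≤ r → manipulationCounts E M w = ∅) := by
  constructor
  · intro hr
    constructor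
    · obtain ⟨D, hD, τ, rfl⟩ := hex.resolve_left hr.ne
      exact totalCost_mem hE hM hD hr
    · rintro _ ⟨R, hR, rfl, hw⟩
      obtain ⟨D, hD, τ, hτ⟩ := exists_totalCost_eq hE hM hR hw
      exact hτ ▸ hle D hD τ
  · intro hr
    refine Set.eq_empty_of_forall_notMem ?_
    rintro _ ⟨R, hR, rfl, hw⟩
    obtain ⟨D, hD, τ, hτ⟩ := exists_totalCost_eq hE hM hR hw
    -- A successful manipulation would give `r ≤ R.card ≤ n * n`.
    have h₁ := hle D hD τ
    have h₂ := R.card_le_univ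
    simp at h₂
    omega

end Reduction

/-! ## Reasoning about programs -/

namespace RAM

@[simp] theorem State.reg_setReg (s : State) (x a y : ℕ) :
    (s.setReg x a).reg y = if y = x then a else s.reg y := by
  simp [State.setReg, Function.update_apply]

@[simp] theorem State.mem_setReg (s : State) (x a : ℕ) : (s.setReg x a).mem = s.mem := rfl

@[simp] theorem State.reg_setMem (s : State) (i a : ℕ) : (s.setMem i a).reg = s.reg := rfl

@[simp] theorem State.mem_setMem (s : State) (i a j : ℕ) :
    (s.setMem i a).mem j = if j = i then a else s.mem j := by
  simp [State.setMem, Function.update_apply]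

namespace Program

/-- Does the program assign to the register `y`? -/
def writes (y : ℕ) : Program → Bool
  | const x _ => y == x
  | copy x _ => y == x
  | add x _ _ => y == x
  | sub x _ _ => y == x
  | load x _ => y == x
  | store _ _ => false
  | skip => false
  | seq p q => p.writes y || q.writes y
  | cond _ p q => p.writes y || q.writes y
  | loop _ p => p.writes y

/-- Does the program write to the memory? -/
def stores : Program → Bool
  | store _ _ => true
  | seq p q => p.stores || q.stores
  | cond _ p q => p.stores || q.stores
  | loop _ p => p.stores
  | _ => false

/-- Is the program free of loops? -/
def loopFree : Program → Bool
  | loop _ _ => false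
  | seq p q => p.loopFree && q.loopFree
  | cond _ p q => p.loopFree && q.loopFree
  | _ => true

/-- The final state of a loop-free program. -/
def eval : Program → State → State
  | const x a, s => s.setReg x a
  | copy x y, s => s.setReg x (s.reg y)
  | add x y z, s => s.setReg x (s.reg y + s.reg z)
  | sub x y z, s => s.setReg x (s.reg y - s.reg z)
  | load x y, s => s.setReg x (s.mem (s.reg y))
  | store x y, s => s.setMem (s.reg x) (s.reg y)
  | skip, s => s
  | seq p q, s => q.eval (p.eval s)
  | cond x p q, s => if s.reg x = 0 then q.eval s else p.eval s
  | loop _ _, s => s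

/-- A bound for the number of steps of a loop-free program. -/
def time : Program → ℕ
  | seq p q => p.time + q.time
  | cond _ p q => max p.time q.time + 1
  | _ => 1

/-- The sequential composition of a list of programs. -/
def block : List Program → Program
  | [] => skip
  | [p] => p
  | p :: q :: l => seq p (block (q :: l))

end Program

theorem Exec.reg_eq {P : Program} {s s' : State} {t : ℕ} (h : Exec P s s' t) {y : ℕ}
    (hy : P.writes y = false) : s'.reg y = s.reg y := by
  induction h <;> simp_all [Program.writes]

theorem Exec.mem_eq {P : Program} {s s' : State} {t : ℕ} (h : Exec P s s' t)
    (hP : P.stores = false) : s'.mem = s.mem := by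
  induction h <;> simp_all [Program.stores]

/-- Turns claims about loop-free code into computations with `eval`, so that only loops need
invariants. -/
theorem exec_eval (P : Program) (hP : P.loopFree = true) (s : State) :
    ∃ t, Exec P s (P.eval s) t ∧ t ≤ P.time := by
  induction P generalizing s with
  | seq p q ihp ihq =>
    simp only [Program.loopFree, Bool.and_eq_true] at hP
    obtain ⟨t, h, ht⟩ := ihp hP.1 s
    obtain ⟨t', h', ht'⟩ := ihq hP.2 (p.eval s)
    exact ⟨t + t', .seq h h', Nat.add_le_add ht ht'⟩
  | cond x p q ihp ihq =>
    simp only [Program.loopFree, Bool.and_eq_true] at hP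
    obtain ⟨t, h, ht⟩ := ihp hP.1 s
    obtain ⟨t', h', ht'⟩ := ihq hP.2 s
    by_cases hx : s.reg x = 0
    · refine ⟨t' + 1, ?_, Nat.succ_le_succ (ht'.trans (le_max_right _ _))⟩
      simp only [Program.eval, if_pos hx]
      exact .cond_eq hx h'
    · refine ⟨t + 1, ?_, Nat.succ_le_succ (ht.trans (le_max_left _ _))⟩
      simp only [Program.eval, if_neg hx]
      exact .cond_ne hx h
  | loop => simp [Program.loopFree] at hP
  | _ => exact ⟨1, by constructor, le_rfl⟩

/-- Started in `s`, the program `P` halts within `T` steps in a state that satisfies `Q`. -/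
def Halts (P : Program) (s : State) (T : ℕ) (Q : State → Prop) : Prop :=
  ∃ s' t, Exec P s s' t ∧ t ≤ T ∧ Q s'

/-- The states `s` and `s'` agree on everything that `P` does not write to. -/
def Same (P : Program) (s s' : State) : Prop :=
  (∀ y, P.writes y = false → s'.reg y = s.reg y) ∧ (P.stores = false → s'.mem = s.mem)

theorem Same.refl (P : Program) (s : State) : Same P s s :=
  ⟨fun _ _ => rfl, fun _ => rfl⟩

theorem Same.trans {P : Program} {s₁ s₂ s₃ : State} (h₁ : Same P s₁ s₂) (h₂ : Same P s₂ s₃) :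
    Same P s₁ s₃ :=
  ⟨fun y hy => (h₂.1 y hy).trans (h₁.1 y hy), fun hP => (h₂.2 hP).trans (h₁.2 hP)⟩

namespace Halts

variable {P P' : Program} {s : State} {T T' : ℕ} {Q Q' : State → Prop}

theorem mono (h : Halts P s T Q) (hT : T ≤ T') (hQ : ∀ s', Q s' → Q' s') : Halts P s T' Q' := by
  obtain ⟨s', t, h, ht, hs⟩ := h
  exact ⟨s', t, h, ht.trans hT, hQ s' hs⟩

/-- The frame rule: whatever is not written, as decided syntactically, may be added to any
postcondition. -/
theorem same (h : Halts P s T Q) : Halts P s T fun s' => Q s' ∧ Same P s s' := by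
  obtain ⟨s', t, h, ht, hs⟩ := h
  exact ⟨s', t, h, ht, hs, fun _ hy => h.reg_eq hy, h.mem_eq⟩

theorem of_eval (hP : P.loopFree = true) (hQ : Q (P.eval s)) : Halts P s P.time Q := by
  obtain ⟨t, h, ht⟩ := exec_eval P hP s
  exact ⟨_, t, h, ht, hQ⟩

theorem seq (h : Halts P s T Q) (h' : ∀ s', Q s' → Halts P' s' T' Q') :
    Halts (.seq P P') s (T + T') Q' := by
  obtain ⟨s', t, h, ht, hs⟩ := h
  obtain ⟨s'', t', h', ht', hs'⟩ := h' s' hs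
  exact ⟨s'', t + t', .seq h h', Nat.add_le_add ht ht', hs'⟩

/-- A loop with invariant `I` whose body decreases `V`. -/
theorem loop {x : ℕ} (I : State → Prop) (V : State → ℕ)
    (hb : ∀ s', I s' → Same P s s' → s'.reg x ≠ 0 →
      Halts P s' T fun s'' => I s'' ∧ V s'' < V s') (hs : I s) :
    Halts (.loop x P) s (V s * (T + 1) + 1) fun s' => I s' ∧ s'.reg x = 0 := by
  suffices H : ∀ v s₁, V s₁ = v → I s₁ → Same P s s₁ →
      Halts (.loop x P) s₁ (v * (T + 1) + 1) fun s' => I s' ∧ s'.reg x = 0 from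
    H _ s rfl hs (.refl P s)
  intro v
  induction v using Nat.strong_induction_on with
  | _ v ih =>
    rintro s₁ rfl hI hsame
    by_cases hx : s₁.reg x = 0
    · exact ⟨s₁, 1, .loop_eq hx, by omega, hI, hx⟩
    · obtain ⟨s', t, h, ht, ⟨hs', hlt⟩, hsame'⟩ := (hb s₁ hI hsame hx).same
      obtain ⟨s'', t', h', ht', hs''⟩ := ih _ hlt s' rfl hs' (hsame.trans hsame')
      refine ⟨s'', t + t' + 1, .loop_ne hx h h', ?_, hs''⟩
      -- One unit of the measure pays for one round, namely `T` steps for the body and one test.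
      have : (V s' + 1) * (T + 1) ≤ V s₁ * (T + 1) := Nat.mul_le_mul_right _ hlt
      rw [Nat.add_mul] at this
      omega

/-- A loop that is executed `B` times, with an invariant `I k` after `k` rounds. -/
theorem loop_count {x B : ℕ} (I : ℕ → State → Prop) (hx : ∀ k s, k ≤ B → I k s → s.reg x = B - k)
    (hb : ∀ k s', k < B → I k s' → Same P s s' → Halts P s' T (I (k + 1))) (hs : I 0 s) :
    Halts (.loop x P) s (B * (T + 1) + 1) (I B) := by
  have hB : s.reg x = B := by simpa using hx 0 s (Nat.zero_le B) hs
  have := Halts.loop (P := P) (T := T) (x := x) (s := s)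
    (fun s => ∃ k ≤ B, I k s) (fun s => s.reg x) (fun s' ⟨k, hk, hI⟩ hsame h0 => ?_)
    ⟨0, Nat.zero_le B, hs⟩
  · rw [hB] at this
    refine this.mono le_rfl fun s' ⟨⟨k, hk, hI⟩, h0⟩ => ?_
    have := hx k s' hk hI
    obtain rfl : k = B := by omega
    exact hI
  · have h₁ := hx k s' hk hI
    have hlt : k < B := by omega
    refine (hb k s' hlt hI hsame).mono le_rfl fun s'' hs'' => ⟨⟨k + 1, hlt, hs''⟩, ?_⟩
    have := hx (k + 1) s'' hlt hs''
    omega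

end Halts

end RAM

/-! ## The program -/

namespace RAM

open Program

/-- Set up the constants: with `N = n * n`, registers `2, …, 5` hold `1`, `N`, `N + 1` and
`(N + 1) * (N + 1)`, registers `10, 11, 12` the addresses of the prices, the owners and the costs.
Register `6` is the target score, register `7` the best cost found so far and register `8` the
number of target scores left. -/
def setup : Program :=
  .seq (block [const 2 1, const 3 0, copy 9 0]) <|
  .seq (.loop 9 (block [add 3 3 0, sub 9 9 2])) <|
  .seq (block [add 4 3 2, const 5 0, copy 9 4]) <|
  .seq (.loop 9 (block [add 5 5 4, sub 9 9 2])) <|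
  -- The best cost is kept multiplied by `N + 1`; its initial value `(N + 1) * (N + 1)` encodes the
  -- unattainable cost `N + 1`. There are `n + 1` target scores, from `0` to `n`.
  block [copy 7 5, const 6 0, add 8 0 2, add 10 3 3, add 11 10 3, add 12 10 10]

/-- Set all prices and owners to `0`. -/
def clear : Program :=
  -- The number `2 * N` in register 10 is both the first address to clear and the number of cells.
  .seq (block [copy 20 10, const 21 0, copy 22 10]) <|
  .loop 22 (block [store 20 21, add 20 20 2, sub 22 22 2])

/-- Store the scaled cost of assigning the pair in registers `21, 22` to the slot in registers
`23, 24` at the address in register `20`. -/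
def writeCost : Program :=
  .seq (block [load 30 29, add 31 29 3, load 31 31,
    -- The sum of the two truncated differences is zero exactly when the numbers agree; register 37
    -- is zero exactly when the slot index is at least the target score.
    sub 33 23 21, sub 34 21 23, add 33 33 34,
    sub 35 23 22, sub 34 22 23, add 35 35 34,
    sub 36 23 1, sub 34 1 23, add 36 36 34,
    sub 37 6 24]) <|
  .seq (.cond 30
    (.seq (.cond 33 (.cond 35 (copy 32 5) (.cond 31 (copy 32 4) (copy 32 5))) (const 32 0))
      (.cond 36 (.cond 37 skip (add 32 32 5)) skip))
    (.cond 36 (const 32 0) (.cond 37 (copy 32 5) (const 32 0)))) <|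
  store 20 32

/-- Advance to the next pair and slot. -/
def advance : Program :=
  block [add 20 20 2, sub 38 38 2, add 24 24 2, sub 34 0 24,
    .cond 34 skip (block [const 24 0, add 23 23 2, sub 34 0 23,
      .cond 34 skip (block [const 23 0, add 29 29 2, add 22 22 2, sub 34 0 22,
        .cond 34 skip (block [const 22 0, add 21 21 2])])])]

/-- Write the table of costs for the target score in register `6`. -/
def table : Program :=
  .seq (block [copy 20 12, const 21 0, const 22 0, const 23 0, const 24 0, const 29 0,
    -- Without multiplication, `N * N` is obtained as `(N + 1) * (N + 1) - 2 * N - 1`.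
    sub 38 5 10, sub 38 38 2]) <|
  .loop 38 (.seq writeCost advance)

/-- Find the best slot for the person whose row of costs starts at the address in register `15`. -/
def scan : Program :=
  .seq (block [const 20 0, copy 21 3, copy 22 15, copy 23 10, const 25 0, load 24 22, load 27 23,
    add 24 24 27]) <|
  .loop 21 (block [load 26 22, load 27 23, add 26 26 27, sub 27 24 26,
    .cond 27 (.seq (copy 24 26) (copy 25 20)) skip,
    add 20 20 2, add 22 22 2, add 23 23 2, sub 21 21 2])

/-- Assign the slot in register `25` to the person in register `15`, raise its price, and continue
with the former owner. -/
def assign : Program :=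
  block [add 28 10 25, load 29 28, add 29 29 2, store 28 29,
    add 28 11 25, load 29 28, store 28 15, copy 15 29]

/-- The auction: the persons enter one after the other. -/
def auction : Program :=
  .seq (block [copy 13 12, copy 14 3]) <|
  .loop 14 <|
    .seq (copy 15 13) <|
    -- Register 15 holds the row address of the unplaced person; it becomes 0 when the slot just
    -- taken was free.
    .seq (.loop 15 (.seq scan assign)) <|
    block [add 13 13 3, sub 14 14 2]

/-- Add up the costs of the assignment. -/
def sumCosts : Program :=
  .seq (block [const 16 0, copy 21 3, copy 22 11, const 20 0]) <|
  .loop 21 (block [load 23 22, add 23 23 20, load 23 23, add 16 16 23, add 22 22 2, add 20 20 2,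
    sub 21 21 2])

/-- Treat one target score. -/
def round : Program :=
  .seq clear <| .seq table <| .seq auction <| .seq sumCosts <|
  block [sub 21 7 16, .cond 21 (copy 7 16) skip, add 6 6 2, sub 8 8 2]

/-- Report the result. -/
def report : Program :=
  .seq (sub 9 5 7) <|
  .cond 9
    -- Division by `N + 1` through repeated subtraction, which undoes the scaling.
    (.seq (block [const 0 1, const 1 0]) (.loop 7 (block [add 1 1 2, sub 7 7 4])))
    (const 0 0)

/-- The whole algorithm. -/
def main : Program :=
  .seq setup <| .seq (.loop 8 round) report

/-! ## Correctness and running time of the parts -/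

/-- The contents of the registers that are constant after the setup. -/
structure Consts (n w : ℕ) (s : State) : Prop where
  r0 : s.reg 0 = n
  r1 : s.reg 1 = w
  r2 : s.reg 2 = 1
  r3 : s.reg 3 = n * n
  r4 : s.reg 4 = n * n + 1
  r5 : s.reg 5 = (n * n + 1) * (n * n + 1)
  r10 : s.reg 10 = 2 * (n * n)
  r11 : s.reg 11 = 3 * (n * n)
  r12 : s.reg 12 = 4 * (n * n)

/-- Does the program leave the constant registers alone? -/
def keepsConsts (P : Program) : Bool :=
  [0, 1, 2, 3, 4, 5, 10, 11, 12].all fun y => !P.writes y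

theorem Consts.of_same {n w : ℕ} {s s' : State} {P : Program} (h : Consts n w s)
    (hs : Same P s s') (hP : keepsConsts P = true) : Consts n w s' := by
  simp only [keepsConsts, List.all_cons, List.all_nil, Bool.and_true, Bool.and_eq_true,
    Bool.not_eq_true'] at hP
  obtain ⟨h0, h1, h2, h3, h4, h5, h10, h11, h12⟩ := hP
  exact ⟨(hs.1 _ h0).trans h.r0, (hs.1 _ h1).trans h.r1, (hs.1 _ h2).trans h.r2,
    (hs.1 _ h3).trans h.r3, (hs.1 _ h4).trans h.r4, (hs.1 _ h5).trans h.r5,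
    (hs.1 _ h10).trans h.r10, (hs.1 _ h11).trans h.r11, (hs.1 _ h12).trans h.r12⟩

theorem setup_halts {n w : ℕ} {s : State} (h0 : s.reg 0 = n) (h1 : s.reg 1 = w) :
    Halts setup s (3 + ((n * (2 + 1) + 1) + (3 + (((n * n + 1) * (2 + 1) + 1) + 6))))
      fun s' => Consts n w s' ∧ s'.mem = s.mem ∧ s'.reg 6 = 0 ∧
        s'.reg 7 = (n * n + 1) * (n * n + 1) ∧ s'.reg 8 = n + 1 := by
  refine Halts.seq (Halts.of_eval rfl (Q := fun s' => s'.mem = s.mem ∧ s'.reg 0 = n ∧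
    s'.reg 1 = w ∧ s'.reg 2 = 1 ∧ s'.reg 3 = 0 ∧ s'.reg 9 = n) ?_) ?_
  · simp [eval, block, h0, h1]
  rintro s₁ ⟨hm₁, h0₁, h1₁, h2₁, h3₁, h9₁⟩
  refine Halts.seq (Halts.same <| Halts.loop_count
    (fun k s' => s'.reg 9 = n - k ∧ s'.reg 3 = k * n) (fun k s' _ h => h.1) ?_
    ⟨h9₁, by simpa using h3₁⟩) ?_
  · rintro k s₂ hk ⟨h9, h3⟩ hs
    refine Halts.of_eval rfl ?_
    have e2 := (hs.1 2 rfl).trans h2₁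
    have e0 := (hs.1 0 rfl).trans h0₁
    simp [eval, block, h9, h3, e2, e0, Nat.sub_sub, Nat.add_mul]
  rintro s₂ ⟨⟨-, h3₂⟩, hs₂⟩
  refine Halts.seq (Halts.of_eval rfl (Q := fun s' => s'.mem = s.mem ∧ s'.reg 0 = n ∧
    s'.reg 1 = w ∧ s'.reg 2 = 1 ∧ s'.reg 3 = n * n ∧ s'.reg 4 = n * n + 1 ∧ s'.reg 5 = 0 ∧
    s'.reg 9 = n * n + 1) ?_) ?_
  · simp [eval, block, hs₂.1 0 rfl, hs₂.1 1 rfl, hs₂.1 2 rfl, hs₂.2 rfl, h3₂, h0₁, h1₁, h2₁, hm₁]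
  rintro s₃ ⟨hm₃, h0₃, h1₃, h2₃, h3₃, h4₃, h5₃, h9₃⟩
  refine Halts.seq (Halts.same <| Halts.loop_count
    (fun k s' => s'.reg 9 = n * n + 1 - k ∧ s'.reg 5 = k * (n * n + 1)) (fun k s' _ h => h.1) ?_
    ⟨h9₃, by simpa using h5₃⟩) ?_
  · rintro k s₄ hk ⟨h9, h5⟩ hs
    refine Halts.of_eval rfl ?_
    have e2 := (hs.1 2 rfl).trans h2₃
    have e4 := (hs.1 4 rfl).trans h4₃
    simp only [eval, block, State.reg_setReg, h9, h5, e2, e4]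
    refine ⟨by simp; omega, by simp; ring⟩
  rintro s₄ ⟨⟨-, h5₄⟩, hs₄⟩
  refine Halts.of_eval rfl ?_
  have e0 := (hs₄.1 0 rfl).trans h0₃
  have e1 := (hs₄.1 1 rfl).trans h1₃
  have e2 := (hs₄.1 2 rfl).trans h2₃
  have e3 := (hs₄.1 3 rfl).trans h3₃
  have e4 := (hs₄.1 4 rfl).trans h4₃
  have em := (hs₄.2 rfl).trans hm₃
  refine ⟨?_, by simpa [eval, block] using em, ?_⟩
  · constructor <;> simp [eval, block, e0, e1, e2, e3, e4, h5₄] <;> ring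
  · simp [eval, block, e0, e2, h5₄]

theorem clear_halts {n w : ℕ} {s : State} (h : Consts n w s) :
    Halts clear s (3 + (2 * (n * n) * (3 + 1) + 1)) fun s' => ∀ a, s'.mem a =
      if 2 * (n * n) ≤ a ∧ a < 4 * (n * n) then 0 else s.mem a := by
  refine Halts.seq (Halts.of_eval rfl (Q := fun s' => s'.mem = s.mem ∧
    s'.reg 20 = 2 * (n * n) ∧ s'.reg 21 = 0 ∧ s'.reg 22 = 2 * (n * n) ∧ s'.reg 2 = 1) ?_) ?_
  · simp [eval, block, h.r10, h.r2]
  rintro s₁ ⟨hm, h20, h21, h22, h2⟩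
  refine (Halts.loop_count (fun k s' => s'.reg 22 = 2 * (n * n) - k ∧ s'.reg 20 = 2 * (n * n) + k ∧
    ∀ a, s'.mem a = if 2 * (n * n) ≤ a ∧ a < 2 * (n * n) + k then 0 else s.mem a)
    (fun k s' _ h => h.1) ?_ ?_).mono le_rfl ?_
  · rintro k s₂ hk ⟨hc, hp, hmem⟩ hs
    refine Halts.of_eval rfl ?_
    have e2 := (hs.1 2 rfl).trans h2
    have e21 := (hs.1 21 rfl).trans h21
    simp only [eval, block, State.reg_setReg, State.mem_setReg, State.reg_setMem,
      State.mem_setMem, hc, hp, e2, e21, hmem]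
    refine ⟨by simp; omega, by simp; omega, fun a => ?_⟩
    split_ifs <;> omega
  · refine ⟨h22, h20, fun a => ?_⟩
    rw [hm]
    split_ifs <;> first | rfl | omega
  · rintro s₂ ⟨-, -, hmem⟩ a
    rw [hmem]
    split_ifs <;> first | rfl | omega

/-! ### Numbering of pairs and the table of costs -/

/-- The position of the pair or slot `x` among the numbers below `n * n`. -/
def cell {n : ℕ} (x : Fin n × Fin n) : ℕ := x.1 * n + x.2

theorem cell_lt {n : ℕ} (x : Fin n × Fin n) : cell x < n * n := by
  have h₁ := x.1.2
  have h₂ := x.2.2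
  have : (x.1 + 1) * n ≤ n * n := Nat.mul_le_mul_right n h₁
  rw [Nat.add_mul] at this
  unfold cell
  omega

theorem mul_add_inj {m a b c d : ℕ} (hb : b < m) (hd : d < m) (h : a * m + b = c * m + d) :
    a = c ∧ b = d := by
  have h₁ := congrArg (· / m) h
  have h₂ := congrArg (· % m) h
  simp only [Nat.mul_add_mod_of_lt hb, Nat.mul_add_mod_of_lt hd] at h₂
  subst h₂
  exact ⟨Nat.eq_of_mul_eq_mul_right (by omega) (Nat.add_right_cancel h), rfl⟩

theorem cell_inj {n : ℕ} {x y : Fin n × Fin n} (h : cell x = cell y) : x = y := by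
  obtain ⟨h₁, h₂⟩ := mul_add_inj x.2.2 y.2.2 h
  exact Prod.ext (Fin.ext h₁) (Fin.ext h₂)

theorem adjacencyCell_cell {n : ℕ} (E : Finset (Fin n × Fin n)) (x : Fin n × Fin n) :
    adjacencyCell E (cell x) = if x ∈ E then 1 else 0 := by
  unfold adjacencyCell
  refine if_congr ⟨?_, fun h => ⟨x, h, rfl⟩⟩ rfl rfl
  rintro ⟨e, he, h⟩
  rwa [cell_inj (x := x) (y := e) h]

/-- The input cells hold the adjacency matrices of `E` and `M`. -/
def HoldsInput {n : ℕ} (E M : Finset (Fin n × Fin n)) (mem : ℕ → ℕ) : Prop :=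
  ∀ x, mem (cell x) = (if x ∈ E then 1 else 0) ∧
    mem (cell x + n * n) = if x ∈ M then 1 else 0

theorem writeCost_halts {n D : ℕ} {E M : Finset (Fin n × Fin n)} {w : Fin n}
    {x y : Fin n × Fin n} {s : State} (h : Consts n w s) (hi : HoldsInput E M s.mem)
    (h6 : s.reg 6 = D) (h21 : s.reg 21 = x.1) (h22 : s.reg 22 = x.2) (h23 : s.reg 23 = y.1)
    (h24 : s.reg 24 = y.2) (h29 : s.reg 29 = cell x) :
    Halts writeCost s (13 + (8 + 1)) fun s' => ∀ a, s'.mem a =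
      if a = s.reg 20 then (n * n + 1) * gameCost E M w D x y else s.mem a := by
  refine Halts.seq (Halts.of_eval rfl (Q := fun s' => s'.mem = s.mem ∧
    s'.reg 20 = s.reg 20 ∧ s'.reg 4 = n * n + 1 ∧ s'.reg 5 = (n * n + 1) * (n * n + 1) ∧
    (s'.reg 30 = 0 ↔ x ∉ E) ∧ (s'.reg 31 = 0 ↔ x ∉ M) ∧ (s'.reg 33 = 0 ↔ y.1 = x.1) ∧
    (s'.reg 35 = 0 ↔ y.1 = x.2) ∧ (s'.reg 36 = 0 ↔ y.1 = w) ∧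
    (s'.reg 37 = 0 ↔ D ≤ (y.2 : ℕ))) ?_) ?_
  · simp [eval, block, h.r1, h.r3, h.r4, h.r5, h6, h21, h22, h23, h24, h29, hi x,
      Nat.sub_eq_zero_iff_le]
    exact ⟨le_antisymm_iff.symm, le_antisymm_iff.symm, le_antisymm_iff.symm⟩
  rintro s₁ ⟨hm, h20, h4, h5, h30, h31, h33, h35, h36, h37⟩
  refine Halts.seq (Halts.same (Halts.of_eval rfl (Q := fun s' => s'.reg 32 =
    (n * n + 1) * gameCost E M w D x y) ?_)) ?_
  · unfold gameCost
    by_cases c1 : x ∈ E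
    · simp only [eval, h30, c1, not_true_eq_false, if_false, if_true]
      by_cases c2 : y.1 = x.1 <;> by_cases c3 : y.1 = x.2 <;> by_cases c4 : x ∈ M <;>
        by_cases c5 : y.1 = w <;> by_cases c6 : D ≤ (y.2 : ℕ) <;>
        simp_all [Nat.mul_add]
    · by_cases c5 : y.1 = w <;> by_cases c6 : D ≤ (y.2 : ℕ) <;> simp_all [eval]
  · rintro s₂ ⟨h32, hs⟩
    refine Halts.of_eval rfl fun a => ?_
    simp only [eval, State.mem_setMem, h32, hs.1 20 rfl, hs.2 rfl, hm, h20]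

/-- The registers point to the `t`-th pair of a pair and a slot. -/
def PointsTo (n t : ℕ) (s : State) : Prop :=
  ∃ a b v k, b < n ∧ v < n ∧ k < n ∧ s.reg 21 = a ∧ s.reg 22 = b ∧ s.reg 23 = v ∧ s.reg 24 = k ∧
    s.reg 29 = a * n + b ∧ t = (a * n + b) * (n * n) + (v * n + k) ∧ s.reg 20 = 4 * (n * n) + t

/-- The four indices form an odometer in base `n`; the cases follow how far the carry propagates,
and each increases `t` by 1. -/
theorem advance_halts {n t : ℕ} {s : State} (h0 : s.reg 0 = n) (h2 : s.reg 2 = 1)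
    (h : PointsTo n t s) :
    Halts advance s 16 fun s' => PointsTo n (t + 1) s' ∧ s'.reg 38 = s.reg 38 - 1 := by
  obtain ⟨a, b, v, k, hb, hv, hk, h21, h22, h23, h24, h29, ht, h20⟩ := h
  refine Halts.of_eval rfl ?_
  by_cases ck : k + 1 = n
  · have ek : n - (k + 1) = 0 := by omega
    have e₁ : (v + 1) * n = v * n + k + 1 := by rw [Nat.add_mul]; omega
    by_cases cv : v + 1 = n
    · have ev : n - (v + 1) = 0 := by omega
      have e₂ : (a * n + b + 1) * (n * n) = t + 1 := by
        rw [Nat.add_mul, ht, one_mul, Nat.add_assoc, Nat.add_assoc, ← Nat.add_assoc (v * n), ← e₁,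
          cv]
      by_cases cb : b + 1 = n
      · have eb : n - (b + 1) = 0 := by omega
        refine ⟨⟨a + 1, 0, 0, 0, ?_⟩, ?_⟩
        · have e₃ : (a + 1) * n = a * n + b + 1 := by rw [Nat.add_mul]; omega
          simp [advance, eval, block, h0, h2, h20, h21, h22, h23, h24, h29, ek, ev, eb, e₃, e₂]
          omega
        · simp [advance, eval, block, h0, h2, h22, h23, h24, ek, ev, eb]
      · have eb : n - (b + 1) ≠ 0 := by omega
        refine ⟨⟨a, b + 1, 0, 0, ?_⟩, ?_⟩
        · simp [advance, eval, block, h0, h2, h20, h21, h22, h23, h24, h29, ek, ev, eb,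
            ← Nat.add_assoc, e₂]
          omega
        · simp [advance, eval, block, h0, h2, h22, h23, h24, ek, ev, eb]
    · have ev : n - (v + 1) ≠ 0 := by omega
      refine ⟨⟨a, b, v + 1, 0, ?_⟩, ?_⟩
      · simp [advance, eval, block, h0, h2, h20, h21, h22, h23, h24, h29, ek, ev, e₁]
        omega
      · simp [advance, eval, block, h0, h2, h23, h24, ek, ev]
  · have ek : n - (k + 1) ≠ 0 := by omega
    refine ⟨⟨a, b, v, k + 1, ?_⟩, ?_⟩
    · simp [advance, eval, block, h0, h2, h20, h21, h22, h23, h24, h29, ek]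
      omega
    · simp [advance, eval, block, h0, h2, h24, ek]

theorem table_halts {n D : ℕ} {E M : Finset (Fin n × Fin n)} {w : Fin n} {s : State}
    (h : Consts n w s) (hi : HoldsInput E M s.mem) (h6 : s.reg 6 = D) :
    Halts table s (8 + (n * n * (n * n) * (13 + (8 + 1) + 16 + 1) + 1)) fun s' =>
      (∀ a < 4 * (n * n), s'.mem a = s.mem a) ∧
      ∀ x y : Fin n × Fin n, s'.mem (4 * (n * n) + cell x * (n * n) + cell y) =
        (n * n + 1) * gameCost E M w D x y := by
  have hn : 0 < n := Nat.lt_of_le_of_lt (Nat.zero_le _) w.2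
  refine Halts.seq (Halts.same (Halts.of_eval rfl (Q := fun s' => PointsTo n 0 s' ∧
    s'.reg 38 = n * n * (n * n)) ?_)) ?_
  · refine ⟨⟨0, 0, 0, 0, ?_⟩, ?_⟩
    · simp [eval, block, h.r12, hn]
    · simp only [eval, block, State.reg_setReg, h.r5, h.r10, h.r2]
      simp [Nat.add_mul, Nat.mul_add]
      omega
  rintro s₁ ⟨⟨hp₁, h38₁⟩, hs₁⟩
  have hc₁ : Consts n w s₁ := h.of_same hs₁ rfl
  have hm₁ : s₁.mem = s.mem := hs₁.2 rfl
  have h6₁ : s₁.reg 6 = D := (hs₁.1 6 rfl).trans h6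
  refine (Halts.loop_count (fun t s' => s'.reg 38 = n * n * (n * n) - t ∧ PointsTo n t s' ∧
    (∀ a < 4 * (n * n), s'.mem a = s.mem a) ∧
    ∀ x y : Fin n × Fin n, cell x * (n * n) + cell y < t →
      s'.mem (4 * (n * n) + (cell x * (n * n) + cell y)) =
        (n * n + 1) * gameCost E M w D x y) (fun t s' _ hI => hI.1) ?_ ?_).mono le_rfl ?_
  · rintro t s₂ ht ⟨h38, hp, hin, htab⟩ hs
    have hc : Consts n w s₂ := hc₁.of_same hs rfl
    have hi₂ : HoldsInput E M s₂.mem := fun x => by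
      have hx := cell_lt x
      rw [hin _ (by omega), hin _ (by omega)]
      exact hi x
    have hp' := hp
    obtain ⟨a, b, v, k, hb, hv, hk, h21, h22, h23, h24, h29, ht', h20⟩ := hp'
    -- `PointsTo` leaves the leading digit unbounded so that it also holds after the last entry;
    -- during the loop the bound follows from `t < n * n * (n * n)`.
    have ha : a < n := by
      by_contra! hge
      have h₁ : n * n ≤ a * n + b := (Nat.mul_le_mul_right n hge).trans (Nat.le_add_right _ _)
      have h₂ := Nat.mul_le_mul_right (n * n) h₁
      omega
    have hwc := writeCost_halts (x := (⟨a, ha⟩, ⟨b, hb⟩)) (y := (⟨v, hv⟩, ⟨k, hk⟩)) hc hi₂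
      ((hs.1 6 rfl).trans h6₁) h21 h22 h23 h24 h29
    refine Halts.seq (T := 13 + (8 + 1)) (T' := 16) hwc.same fun s₃ ⟨hm₃, hs₃⟩ => ?_
    have hp₃ : PointsTo n t s₃ := by
      refine ⟨a, b, v, k, hb, hv, hk, ?_⟩
      rw [hs₃.1 20 rfl, hs₃.1 21 rfl, hs₃.1 22 rfl, hs₃.1 23 rfl, hs₃.1 24 rfl, hs₃.1 29 rfl]
      exact ⟨h21, h22, h23, h24, h29, ht', h20⟩
    have hc₃ := hc.of_same hs₃ rfl
    refine (advance_halts hc₃.r0 hc₃.r2 hp₃).same.mono le_rfl fun s₄ ⟨⟨hp₄, h38₄⟩, hs₄⟩ => ?_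
    refine ⟨?_, hp₄, fun c hc => ?_, fun x y hxy => ?_⟩
    · rw [h38₄, hs₃.1 38 rfl, h38]
      omega
    · rw [hs₄.2 rfl, hm₃, if_neg (by omega)]
      exact hin c hc
    · rw [hs₄.2 rfl, hm₃, h20]
      rcases Nat.lt_succ_iff_lt_or_eq.1 hxy with hlt | heq
      · rw [if_neg (by omega)]
        exact htab x y hlt
      · rw [if_pos (by rw [heq])]
        obtain ⟨hx, hy⟩ := mul_add_inj (cell_lt y)
          (cell_lt ((⟨v, hv⟩, ⟨k, hk⟩) : Fin n × Fin n)) (heq.trans ht')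
        rw [cell_inj (x := x) (y := (⟨a, ha⟩, ⟨b, hb⟩)) hx, cell_inj hy]
  · exact ⟨by simpa using h38₁, hp₁, fun a _ => by rw [hm₁], fun x y h => absurd h (by omega)⟩
  · rintro s₂ ⟨-, -, hin, htab⟩
    refine ⟨hin, fun x y => ?_⟩
    rw [Nat.add_assoc]
    refine htab x y ?_
    have h₁ := Nat.mul_le_mul_right (n * n) (cell_lt x)
    have h₂ := cell_lt y
    rw [Nat.succ_mul] at h₁
    omega

/-! ### The auction on the machine -/

/-- The address of the row of costs of a person. -/
def rowAddress {N : ℕ} : Option (Fin N) → ℕ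
  | none => 0
  | some i => 4 * N + i * N

/-- Any person forces `N > 0`, so row addresses are positive and 0 can code the absence of a person,
both for owners and as loop guard. -/
theorem rowAddress_eq_zero {N : ℕ} {c : Option (Fin N)} : rowAddress c = 0 ↔ c = none := by
  cases c with
  | none => simp [rowAddress]
  | some i =>
    have := i.2
    simp only [rowAddress, reduceCtorEq, iff_false]
    omega

/-- The memory holds the prices `p`, the owners `o` and the costs `C`; its input cells are those
of `mem₀`. -/
structure Layout {N : ℕ} (C : Fin N → Fin N → ℕ) (mem₀ : ℕ → ℕ) (p : Fin N → ℕ)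
    (o : Fin N → Option (Fin N)) (mem : ℕ → ℕ) : Prop where
  input : ∀ a < 2 * N, mem a = mem₀ a
  price : ∀ j : Fin N, mem (2 * N + j) = p j
  owner : ∀ j : Fin N, mem (3 * N + j) = rowAddress (o j)
  costs : ∀ i j : Fin N, mem (4 * N + i * N + j) = C i j

theorem Layout.bid {N : ℕ} {C : Fin N → Fin N → ℕ} {mem₀ mem mem' : ℕ → ℕ} {p : Fin N → ℕ}
    {o : Fin N → Option (Fin N)} (h : Layout C mem₀ p o mem) {i j : Fin N}
    (h' : ∀ a, mem' a = if a = 3 * N + j then rowAddress (some i)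
      else if a = 2 * N + j then p j + 1 else mem a) :
    Layout C mem₀ (Function.update p j (p j + 1)) (Function.update o j (some i)) mem' where
  input a ha := by
    rw [h', if_neg (by omega), if_neg (by omega), h.input a ha]
  price k := by
    have hk := k.2
    rw [h', if_neg (by omega), h.price, Function.update_apply]
    refine if_congr ?_ rfl rfl
    rw [Fin.ext_iff]
    omega
  owner k := by
    have hj := j.2
    rw [h', Function.update_apply]
    by_cases hkj : k = j
    · rw [if_pos (by rw [hkj]), if_pos hkj]
    · have := Fin.val_ne_of_ne hkj
      rw [if_neg (by omega), if_neg (by omega), if_neg hkj, h.owner]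
  costs i' k := by
    have hj := j.2
    rw [h', if_neg (by omega), if_neg (by omega), h.costs]

section

variable {n w : ℕ} {C : Fin (n * n) → Fin (n * n) → ℕ} {mem₀ : ℕ → ℕ} {p : Fin (n * n) → ℕ}
  {o : Fin (n * n) → Option (Fin (n * n))} {s : State}

theorem scan_halts (h : Consts n w s) {i : Fin (n * n)} (hl : Layout C mem₀ p o s.mem)
    (h15 : s.reg 15 = rowAddress (some i)) :
    Halts scan s (8 + (n * n * (11 + 1) + 1)) fun s' => ∃ j : Fin (n * n), s'.reg 25 = j ∧
      ∀ j', C i j + p j ≤ C i j' + p j' := by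
  have hN : 0 < n * n := Nat.lt_of_le_of_lt (Nat.zero_le _) i.2
  simp only [rowAddress] at h15
  refine Halts.seq (Halts.same <| Halts.of_eval rfl (Q := fun s' => s'.reg 20 = 0 ∧
    s'.reg 21 = n * n ∧ s'.reg 22 = 4 * (n * n) + i * (n * n) ∧ s'.reg 23 = 2 * (n * n) ∧
    s'.reg 25 = 0 ∧ s'.reg 24 = C i ⟨0, hN⟩ + p ⟨0, hN⟩) ?_) ?_
  · have h₁ := hl.costs i ⟨0, hN⟩
    have h₂ := hl.price ⟨0, hN⟩
    simp only [Nat.add_zero] at h₁ h₂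
    simp [eval, block, h.r3, h.r10, h15, h₁, h₂]
  rintro s₁ ⟨⟨h20, h21, h22, h23, h25, h24⟩, hs₁⟩
  have hm : s₁.mem = s.mem := hs₁.2 rfl
  have h2 : s₁.reg 2 = 1 := (hs₁.1 2 rfl).trans h.r2
  refine (Halts.loop_count (fun k s' => s'.reg 21 = n * n - k ∧ s'.reg 20 = k ∧
    s'.reg 22 = 4 * (n * n) + i * (n * n) + k ∧ s'.reg 23 = 2 * (n * n) + k ∧
    ∃ j : Fin (n * n), s'.reg 25 = j ∧ s'.reg 24 = C i j + p j ∧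
      ∀ j' : Fin (n * n), (j' : ℕ) < k → C i j + p j ≤ C i j' + p j')
    (fun k s' _ hI => hI.1) ?_ ?_).mono le_rfl ?_
  · rintro k s₂ hk ⟨e21, e20, e22, e23, j, e25, e24, hj⟩ hs
    have e2 : s₂.reg 2 = 1 := (hs.1 2 rfl).trans h2
    have em : s₂.mem = s.mem := (hs.2 rfl).trans hm
    have hc := hl.costs i ⟨k, hk⟩
    have hp := hl.price ⟨k, hk⟩
    dsimp only at hc hp
    refine Halts.of_eval rfl ?_
    -- The truncated difference is zero when the new slot is not strictly better; the earlier slot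
    -- is then kept.
    by_cases hlt : C i j + p j - (C i ⟨k, hk⟩ + p ⟨k, hk⟩) = 0
    · simp [eval, block, em, e20, e21, e22, e23, e24, e25, e2, hc, hp, hlt]
      refine ⟨by omega, by omega, by omega, j, rfl, rfl, fun j' hj' => ?_⟩
      rcases hj'.lt_or_eq with h₁ | h₁
      · exact hj j' h₁
      · obtain rfl : j' = ⟨k, hk⟩ := Fin.ext h₁
        omega
    · simp [eval, block, em, e20, e21, e22, e23, e24, e2, hc, hp, hlt]
      refine ⟨by omega, by omega, by omega, ⟨k, hk⟩, rfl, rfl, fun j' hj' => ?_⟩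
      rcases hj'.lt_or_eq with h₁ | h₁
      · have := hj j' h₁
        omega
      · obtain rfl : j' = ⟨k, hk⟩ := Fin.ext h₁
        exact le_rfl
  · exact ⟨h21, h20, h22, h23, ⟨0, hN⟩, h25, h24, fun j' hj' => absurd hj' (Nat.not_lt_zero _)⟩
  · rintro s₂ ⟨-, -, -, -, j, e25, -, hj⟩
    exact ⟨j, e25, fun j' => hj j' j'.2⟩

theorem assign_halts (h : Consts n w s) {i j : Fin (n * n)} (hl : Layout C mem₀ p o s.mem)
    (h15 : s.reg 15 = rowAddress (some i)) (h25 : s.reg 25 = j) :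
    Halts assign s 8 fun s' => s'.reg 15 = rowAddress (o j) ∧
      Layout C mem₀ (Function.update p j (p j + 1)) (Function.update o j (some i)) s'.mem := by
  have hj := j.2
  have hn : n ≠ 0 := by
    rintro rfl
    exact absurd hj (Nat.not_lt_zero _)
  have hp := hl.price j
  have ho := hl.owner j
  refine Halts.of_eval rfl ⟨?_, hl.bid fun a => ?_⟩
  · simp [assign, eval, block, h.r10, h.r11, h25, ho, hn]
  · simp [assign, eval, block, h.r2, h.r10, h.r11, h25, h15, hp]

/-- The number of steps for one bid. -/
def bidTime (N : ℕ) : ℕ := 8 + (N * (11 + 1) + 1) + 8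

/-- The number of steps of the auction when all costs are at most `L`. -/
def auctionTime (N L : ℕ) : ℕ :=
  2 + (N * (1 + (N * (L + 1) * (bidTime N + 1) + 1 + 2) + 1) + 1)

theorem auction_halts {L : ℕ} (h : Consts n w s) (hC : ∀ i j, C i j ≤ L)
    (hl : Layout C mem₀ (fun _ => 0) (fun _ => none) s.mem) :
    Halts auction s (auctionTime (n * n) L) fun s' => ∃ p, ∃ σ : Equiv.Perm (Fin (n * n)),
      Layout C mem₀ p (fun j => some (σ j)) s'.mem ∧
      ∀ τ : Equiv.Perm (Fin (n * n)), ∑ j, C (σ j) j ≤ ∑ j, C (τ j) j + n * n := by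
  refine Halts.seq (Halts.same <| Halts.of_eval rfl (Q := fun s' => s'.reg 13 = 4 * (n * n) ∧
    s'.reg 14 = n * n) ?_) ?_
  · simp [eval, block, h.r3, h.r12]
  rintro s₁ ⟨⟨h13, h14⟩, hs₁⟩
  have hc₁ := h.of_same hs₁ rfl
  have hm₁ : s₁.mem = s.mem := hs₁.2 rfl
  refine (Halts.loop_count (fun k s' => s'.reg 14 = n * n - k ∧
    s'.reg 13 = 4 * (n * n) + k * (n * n) ∧
    ∃ p o, Auction C L k none p o ∧ Layout C mem₀ p o s'.mem)
    (fun k s' _ hI => hI.1) ?_ ?_).mono le_rfl ?_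
  · rintro k s₂ hk ⟨e14, e13, p, o, ha, hl₂⟩ hs
    have hc₂ := hc₁.of_same hs rfl
    refine Halts.seq (Halts.same <| Halts.of_eval rfl
      (Q := fun s' => s'.reg 15 = rowAddress (some (⟨k, hk⟩ : Fin (n * n)))) ?_) ?_
    · simp [eval, e13, rowAddress]
    rintro s₃ ⟨e15, hs₃⟩
    have hc₃ := hc₂.of_same hs₃ rfl
    have hl₃ : Layout C mem₀ p o s₃.mem := by rwa [hs₃.2 rfl]
    refine Halts.seq (Halts.same <| Halts.mono (Halts.loop (T := bidTime (n * n))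
      (fun s' => ∃ cur p o, Auction C L (k + 1) cur p o ∧ Layout C mem₀ p o s'.mem ∧
        s'.reg 15 = rowAddress cur)
      -- The measure reads the prices from memory, since `p` is existentially bound in the
      -- invariant.
      (fun s' => Auction.potential L fun j : Fin (n * n) => s'.mem (2 * (n * n) + j)) ?_
      ⟨_, p, o, ha.enter hk, hl₃, e15⟩)
      -- The full potential `N * (L + 1)` is allowed anew for each entering person; this crude bound
      -- is still polynomial.
      (Nat.add_le_add_right (Nat.mul_le_mul_right _ (Auction.potential_le _ _)) 1)
      fun _ h => h) ?_
    · rintro s₄ ⟨cur, p, o, ha₄, hl₄, f15⟩ hs₄ hne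
      rw [f15, Ne, rowAddress_eq_zero] at hne
      obtain ⟨i, rfl⟩ := Option.ne_none_iff_exists'.1 hne
      have hc₄ := hc₃.of_same hs₄ rfl
      refine Halts.seq (scan_halts hc₄ hl₄ f15).same ?_
      rintro s₅ ⟨⟨j, f25, hj⟩, hs₅⟩
      have hc₅ := hc₄.of_same hs₅ rfl
      have hl₅ : Layout C mem₀ p o s₅.mem := by rwa [hs₅.2 rfl]
      refine (assign_halts hc₅ hl₅ ((hs₅.1 15 rfl).trans f15) f25).mono le_rfl ?_
      rintro s₆ ⟨g15, hl₆⟩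
      refine ⟨⟨o j, _, _, ha₄.bid hC hj, hl₆, g15⟩, ?_⟩
      simp only [hl₆.price, hl₄.price]
      exact Auction.potential_bid_lt (ha₄.price_le hC hj)
    · rintro s₄ ⟨⟨⟨cur, p, o, ha₄, hl₄, f15⟩, h0⟩, hs₄⟩
      rw [f15, rowAddress_eq_zero] at h0
      subst h0
      have f14 := (hs₄.1 14 rfl).trans ((hs₃.1 14 rfl).trans e14)
      have f13 := (hs₄.1 13 rfl).trans ((hs₃.1 13 rfl).trans e13)
      have hc₄ := hc₃.of_same hs₄ rfl
      refine Halts.of_eval rfl ?_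
      simp only [eval, block, State.reg_setReg, State.mem_setReg, f14, f13, hc₄.r2, hc₄.r3]
      refine ⟨by simp; omega, ?_, p, o, ha₄, hl₄⟩
      simp [Nat.add_mul, Nat.add_assoc]
  · refine ⟨h14, by simpa using h13, _, _, Auction.start, ?_⟩
    rwa [hm₁]
  · rintro s₂ ⟨-, -, p, o, ha, hl₂⟩
    obtain ⟨σ, hσ, hopt⟩ := ha.finish
    obtain rfl : o = fun j => some (σ j) := funext hσ
    exact ⟨p, σ, hl₂, hopt⟩

theorem sumCosts_halts (h : Consts n w s) {σ : Equiv.Perm (Fin (n * n))}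
    (hl : Layout C mem₀ p (fun j => some (σ j)) s.mem) :
    Halts sumCosts s (4 + (n * n * (7 + 1) + 1)) fun s' => s'.reg 16 = ∑ j, C (σ j) j := by
  refine Halts.seq (Halts.same <| Halts.of_eval rfl (Q := fun s' => s'.reg 16 = 0 ∧
    s'.reg 21 = n * n ∧ s'.reg 22 = 3 * (n * n) ∧ s'.reg 20 = 0) ?_) ?_
  · simp [eval, block, h.r3, h.r11]
  rintro s₁ ⟨⟨h16, h21, h22, h20⟩, hs₁⟩
  have h2 : s₁.reg 2 = 1 := (hs₁.1 2 rfl).trans h.r2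
  have hm : s₁.mem = s.mem := hs₁.2 rfl
  -- The owner cell of slot `j` holds the row address of its owner, so adding `j` gives the address
  -- of the cost.
  let f : ℕ → ℕ := fun j => s.mem (s.mem (3 * (n * n) + j) + j)
  have hf : ∀ j : Fin (n * n), f j = C (σ j) j := fun j => by
    simp only [f, hl.owner, rowAddress, hl.costs]
  refine (Halts.loop_count (fun k s' => s'.reg 21 = n * n - k ∧ s'.reg 20 = k ∧
    s'.reg 22 = 3 * (n * n) + k ∧ s'.reg 16 = ∑ j ∈ Finset.range k, f j)
    (fun k s' _ hI => hI.1) ?_ ⟨h21, h20, h22, by simpa using h16⟩).mono le_rfl ?_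
  · rintro k s₂ hk ⟨e21, e20, e22, e16⟩ hs
    have e2 : s₂.reg 2 = 1 := (hs.1 2 rfl).trans h2
    have em : s₂.mem = s.mem := (hs.2 rfl).trans hm
    refine Halts.of_eval rfl ?_
    simp [eval, block, em, e20, e21, e22, e16, e2, Finset.sum_range_succ, f]
    omega
  · rintro s₂ ⟨-, -, -, e16⟩
    rw [e16, Finset.sum_range]
    exact Finset.sum_congr rfl fun j _ => hf j

end

/-! ### One target score and the final report -/

theorem Halts.cond_ne {P P' : Program} {s : State} {T x : ℕ} {Q : State → Prop}
    (hx : s.reg x ≠ 0) (h : Halts P s T Q) : Halts (.cond x P P') s (T + 1) Q := by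
  obtain ⟨s', t, h, ht, hs⟩ := h
  exact ⟨s', t + 1, .cond_ne hx h, Nat.succ_le_succ ht, hs⟩

theorem Halts.cond_eq {P P' : Program} {s : State} {T x : ℕ} {Q : State → Prop}
    (hx : s.reg x = 0) (h : Halts P' s T Q) : Halts (.cond x P P') s (T + 1) Q := by
  obtain ⟨s', t, h, ht, hs⟩ := h
  exact ⟨s', t + 1, .cond_eq hx h, Nat.succ_le_succ ht, hs⟩

section

variable {n D r : ℕ} {E M : Finset (Fin n × Fin n)} {w : Fin n} {s : State} {mem₀ : ℕ → ℕ}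

theorem HoldsInput.congr {mem : ℕ → ℕ} (hi : HoldsInput E M mem₀)
    (h : ∀ a < 2 * (n * n), mem a = mem₀ a) : HoldsInput E M mem := fun x => by
  have hx := cell_lt x
  rw [h _ (by omega), h _ (by omega)]
  exact hi x

theorem val_finProdFinEquiv (x : Fin n × Fin n) : (finProdFinEquiv x : ℕ) = cell x := by
  rw [cell, finProdFinEquiv_apply_val, Nat.mul_comm, Nat.add_comm]

/-- The scaled costs of the assignment problem with the target score `D`, on numbered pairs and
slots. -/
def scaledCost (E M : Finset (Fin n × Fin n)) (w : Fin n) (D : ℕ) (i j : Fin (n * n)) : ℕ :=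
  (n * n + 1) * gameCost E M w D (finProdFinEquiv.symm i) (finProdFinEquiv.symm j)

theorem scaledCost_le (i j : Fin (n * n)) :
    scaledCost E M w D i j ≤ (n * n + 1) * (2 * (n * n + 1)) :=
  Nat.mul_le_mul_left _ (gameCost_le D _ _)

theorem sum_scaledCost (σ : Equiv.Perm (Fin (n * n))) :
    ∑ j, scaledCost E M w D (σ j) j =
      (n * n + 1) * totalCost E M w D (finProdFinEquiv.symm.permCongr σ) := by
  rw [totalCost, Finset.mul_sum, ← Equiv.sum_comp finProdFinEquiv]
  simp [scaledCost, Equiv.permCongr_apply]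

/-- The number of steps for one target score. -/
def roundTime (n : ℕ) : ℕ :=
  3 + (2 * (n * n) * (3 + 1) + 1) +
    (8 + (n * n * (n * n) * (13 + (8 + 1) + 16 + 1) + 1) +
      (auctionTime (n * n) ((n * n + 1) * (2 * (n * n + 1))) + (4 + (n * n * (7 + 1) + 1) + 5)))

theorem round_halts (h : Consts n w s) (hi : HoldsInput E M mem₀)
    (hm : ∀ a < 2 * (n * n), s.mem a = mem₀ a) (h6 : s.reg 6 = D)
    (h7 : s.reg 7 = (n * n + 1) * r) :
    Halts round s (roundTime n) fun s' => (∀ a < 2 * (n * n), s'.mem a = mem₀ a) ∧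
      s'.reg 6 = D + 1 ∧ s'.reg 8 = s.reg 8 - 1 ∧
      ∃ τ, s'.reg 7 = (n * n + 1) * min r (totalCost E M w D τ) ∧
        ∀ τ', totalCost E M w D τ ≤ totalCost E M w D τ' := by
  refine Halts.seq (clear_halts h).same ?_
  rintro s₁ ⟨hm₁, hs₁⟩
  have hc₁ := h.of_same hs₁ rfl
  have hin₁ : ∀ a < 2 * (n * n), s₁.mem a = mem₀ a := fun a ha => by
    rw [hm₁, if_neg (by omega), hm a ha]
  refine Halts.seq (table_halts hc₁ (hi.congr hin₁) ((hs₁.1 6 rfl).trans h6)).same ?_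
  rintro s₂ ⟨⟨hm₂, htab⟩, hs₂⟩
  have hc₂ := hc₁.of_same hs₂ rfl
  have hl₂ : Layout (scaledCost E M w D) mem₀ (fun _ => 0) (fun _ => none) s₂.mem := by
    constructor
    · intro a ha
      rw [hm₂ a (by omega), hin₁ a ha]
    · intro j
      have := j.2
      rw [hm₂ _ (by omega), hm₁, if_pos (by omega)]
    · intro j
      have := j.2
      rw [hm₂ _ (by omega), hm₁, if_pos (by omega), rowAddress]
    · intro i j
      have := htab (finProdFinEquiv.symm i) (finProdFinEquiv.symm j)
      rwa [← val_finProdFinEquiv, ← val_finProdFinEquiv, Equiv.apply_symm_apply,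
        Equiv.apply_symm_apply] at this
  refine Halts.seq (auction_halts hc₂ scaledCost_le hl₂).same ?_
  rintro s₃ ⟨⟨p, σ, hl₃, hopt⟩, hs₃⟩
  have hc₃ := hc₂.of_same hs₃ rfl
  refine Halts.seq (sumCosts_halts hc₃ hl₃).same ?_
  rintro s₄ ⟨h16, hs₄⟩
  have hc₄ := hc₃.of_same hs₄ rfl
  have e6 : s₄.reg 6 = D := by
    rw [hs₄.1 6 rfl, hs₃.1 6 rfl, hs₂.1 6 rfl, hs₁.1 6 rfl, h6]
  have e7 : s₄.reg 7 = (n * n + 1) * r := by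
    rw [hs₄.1 7 rfl, hs₃.1 7 rfl, hs₂.1 7 rfl, hs₁.1 7 rfl, h7]
  have e8 : s₄.reg 8 = s.reg 8 := by
    rw [hs₄.1 8 rfl, hs₃.1 8 rfl, hs₂.1 8 rfl, hs₁.1 8 rfl]
  rw [sum_scaledCost] at h16
  set τ := finProdFinEquiv.symm.permCongr σ with hτ
  have hmem : s₄.mem = s₃.mem := hs₄.2 rfl
  -- Scaled totals are multiples of `N + 1`, so a better assignment would be better by at least `N +
  -- 1`, exceeding the auction error `N`.
  have hopt' : ∀ τ', totalCost E M w D τ ≤ totalCost E M w D τ' := fun τ' => by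
    have h₁ := hopt (finProdFinEquiv.permCongr τ')
    have h₂ : finProdFinEquiv.symm.permCongr (finProdFinEquiv.permCongr τ') = τ' := by
      ext x <;> simp [Equiv.permCongr_apply]
    rw [sum_scaledCost, sum_scaledCost, h₂, ← hτ] at h₁
    by_contra! hlt
    have h₃ := Nat.mul_le_mul_left (n * n + 1) hlt
    rw [Nat.succ_eq_add_one, Nat.mul_add] at h₃
    omega
  refine Halts.of_eval rfl ?_
  by_cases hle : (n * n + 1) * r - (n * n + 1) * totalCost E M w D τ = 0
  · have hle' : r ≤ totalCost E M w D τ :=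
      Nat.le_of_mul_le_mul_left (Nat.sub_eq_zero_iff_le.1 hle) (Nat.succ_pos _)
    refine ⟨?_, ?_, ?_, τ, ?_, hopt'⟩
    · simpa [eval, block, e6, e7, h16, hle, hmem] using hl₃.input
    · simp [eval, block, e6, e7, h16, hle, hc₄.r2]
    · simp [eval, block, e7, e8, h16, hle, hc₄.r2]
    · simp [eval, block, e7, h16, hle, min_eq_left hle']
  · have hle' : totalCost E M w D τ ≤ r := by
      by_contra! hlt
      exact hle (Nat.sub_eq_zero_of_le (Nat.mul_le_mul_left _ hlt.le))
    refine ⟨?_, ?_, ?_, τ, ?_, hopt'⟩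
    · simpa [eval, block, e6, e7, h16, hle, hmem] using hl₃.input
    · simp [eval, block, e6, e7, h16, hle, hc₄.r2]
    · simp [eval, block, e7, e8, h16, hle, hc₄.r2]
    · simp [eval, block, e7, h16, hle, min_eq_right hle']

/-- Here `K` is `N + 1`. The comparison of `K * K` with `K * r` decides `r < K` without dividing;
each subtraction of `K` then moves one unit from the quotient still to be counted to register 1. -/
theorem report_halts {K : ℕ} (h2 : s.reg 2 = 1) (h4 : s.reg 4 = K) (h5 : s.reg 5 = K * K)
    (h7 : s.reg 7 = K * r) (hK : 0 < K) :
    Halts report s (1 + (2 + (K * K * (2 + 1) + 1) + 1)) fun s' =>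
      (r < K → s'.reg 0 = 1 ∧ s'.reg 1 = r) ∧ (K ≤ r → s'.reg 0 = 0) := by
  refine Halts.seq (Halts.same <| Halts.of_eval rfl
    (Q := fun s' => s'.reg 9 = K * K - K * r) ?_) ?_
  · simp [eval, h5, h7]
  rintro s₁ ⟨h9, hs₁⟩
  rcases lt_or_ge r K with hr | hr
  · have hlt : K * r < K * K := Nat.mul_lt_mul_of_pos_left hr hK
    refine Halts.cond_ne (by rw [h9]; omega) ?_
    refine Halts.seq (Halts.same <| Halts.of_eval rfl
      (Q := fun s' => s'.reg 0 = 1 ∧ s'.reg 1 = 0) ?_) ?_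
    · simp [eval, block]
    rintro s₂ ⟨⟨e0, e1⟩, hs₂⟩
    have e2 : s₂.reg 2 = 1 := (hs₂.1 2 rfl).trans ((hs₁.1 2 rfl).trans h2)
    have e4 : s₂.reg 4 = K := (hs₂.1 4 rfl).trans ((hs₁.1 4 rfl).trans h4)
    have e7 : s₂.reg 7 = K * r := (hs₂.1 7 rfl).trans ((hs₁.1 7 rfl).trans h7)
    refine (Halts.loop (T := 2) (fun s' => s'.reg 0 = 1 ∧ ∃ q, s'.reg 7 = K * q ∧
      s'.reg 1 + q = r) (fun s' => s'.reg 7) ?_ ⟨e0, r, e7, by omega⟩).mono ?_ ?_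
    · rintro s₃ ⟨f0, q, f7, f1⟩ hs₃ hne
      have f2 : s₃.reg 2 = 1 := (hs₃.1 2 rfl).trans e2
      have f4 : s₃.reg 4 = K := (hs₃.1 4 rfl).trans e4
      have hq : q ≠ 0 := by
        rintro rfl
        exact hne f7
      obtain ⟨q, rfl⟩ := Nat.exists_eq_succ_of_ne_zero hq
      refine Halts.of_eval rfl ⟨⟨?_, q, ?_, ?_⟩, ?_⟩
      · simpa [eval, block] using f0
      · simp [eval, block, f4, f7, Nat.mul_add]
      · simp [eval, block, f2]
        omega
      · simp [eval, block, f4, f7, Nat.mul_add]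
        omega
    · rw [e7]
      have := Nat.mul_le_mul_right (2 + 1) hlt.le
      omega
    · rintro s₃ ⟨⟨f0, q, f7, f1⟩, hz⟩
      rw [hz] at f7
      have hq : q = 0 := by
        rcases Nat.mul_eq_zero.1 f7.symm with h | h
        · omega
        · exact h
      exact ⟨fun _ => ⟨f0, by omega⟩, fun h => absurd h (by omega)⟩
  · have hle : K * K ≤ K * r := Nat.mul_le_mul_left _ hr
    refine (Halts.cond_eq (T := 1) (by rw [h9]; omega) (Halts.of_eval rfl ?_)).mono (by omega)
      fun _ h => h
    exact ⟨fun h => absurd h (by omega), fun _ => by simp [eval]⟩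

end

/-! ### The whole algorithm and its polynomial bound -/

/-- The number of steps of the whole algorithm. -/
def mainTime (n : ℕ) : ℕ :=
  3 + ((n * (2 + 1) + 1) + (3 + (((n * n + 1) * (2 + 1) + 1) + 6))) +
    ((n + 1) * (roundTime n + 1) + 1 +
      (1 + (2 + ((n * n + 1) * (n * n + 1) * (2 + 1) + 1) + 1)))

theorem holdsInput_inputState {n : ℕ} (E M : Finset (Fin n × Fin n)) (w : Fin n) :
    HoldsInput E M (inputState E M w).mem := fun x => by
  have hx := cell_lt x
  simp [inputState, hx, adjacencyCell_cell]

theorem main_halts {n : ℕ} {E M : Finset (Fin n × Fin n)} {w : Fin n} (hE : IsTournament E)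
    (hM : M ⊆ E) :
    Halts main (inputState E M w) (mainTime n) fun s => ReportsMin s (manipulationCounts E M w) := by
  refine Halts.seq (setup_halts (n := n) (w := w) rfl rfl) ?_
  rintro s₁ ⟨hc₁, hm₁, h6, h7, h8⟩
  have hi := holdsInput_inputState E M w
  refine Halts.seq (Halts.same <| Halts.loop_count (T := roundTime n)
    -- After `k` rounds, `r` is the minimum of the sentinel `N + 1` and all assignment costs for
    -- target scores below `k`.
    (fun k s' => s'.reg 8 = n + 1 - k ∧ s'.reg 6 = k ∧
      (∀ a < 2 * (n * n), s'.mem a = (inputState E M w).mem a) ∧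
      ∃ r, s'.reg 7 = (n * n + 1) * r ∧ (∀ D < k, ∀ τ, r ≤ totalCost E M w D τ) ∧
        (r = n * n + 1 ∨ ∃ D < k, ∃ τ, r = totalCost E M w D τ))
    (fun k s' _ hI => hI.1) ?_
    ⟨h8, h6, fun a _ => by rw [hm₁], _, h7, fun D hD => absurd hD (Nat.not_lt_zero D),
      Or.inl rfl⟩) ?_
  · rintro k s₂ hk ⟨e8, e6, hin, r, e7, hle, hex⟩ hs₂
    refine (round_halts (hc₁.of_same hs₂ rfl) hi hin e6 e7).mono le_rfl ?_
    rintro s₃ ⟨hin₃, f6, f8, τ, f7, hopt⟩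
    refine ⟨by rw [f8, e8, Nat.sub_sub], f6, hin₃, _, f7, fun D hD τ' => ?_, ?_⟩
    · rcases Nat.lt_succ_iff_lt_or_eq.1 hD with hD | rfl
      · exact (min_le_left _ _).trans (hle D hD τ')
      · exact (min_le_right _ _).trans (hopt τ')
    · rcases min_choice r (totalCost E M w k τ) with hmin | hmin <;> rw [hmin]
      · rcases hex with h | ⟨D, hD, h⟩
        · exact Or.inl h
        · exact Or.inr ⟨D, hD.trans (Nat.lt_succ_self k), h⟩
      · exact Or.inr ⟨k, Nat.lt_succ_self k, τ, rfl⟩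
  · rintro s₂ ⟨⟨-, -, -, r, e7, hle, hex⟩, hs₂⟩
    have hc₂ := hc₁.of_same hs₂ rfl
    refine (report_halts hc₂.r2 hc₂.r4 hc₂.r5 e7 (Nat.succ_pos _)).mono le_rfl ?_
    rintro s₃ ⟨hlt, hge⟩
    obtain ⟨hleast, hempty⟩ := isLeast_or_eq_empty hE hM
      (fun D hD => hle D (Nat.lt_succ_of_le hD))
      (hex.imp_right fun ⟨D, hD, h⟩ => ⟨D, Nat.le_of_lt_succ hD, h⟩)
    rcases lt_or_ge r (n * n + 1) with hr | hr
    · obtain ⟨g0, g1⟩ := hlt hr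
      exact Or.inl ⟨g0, by rw [g1]; exact hleast hr⟩
    · exact Or.inr ⟨hge hr, hempty hr⟩

open Polynomial in
theorem exists_polynomial_mainTime : ∃ p : ℕ[X], ∀ n, p.eval n = mainTime n := by
  let IsPoly (f : ℕ → ℕ) : Prop := ∃ p : ℕ[X], ∀ n, p.eval n = f n
  have hconst : ∀ c, IsPoly fun _ => c := fun c => ⟨C c, fun n => eval_C⟩
  have hid : IsPoly fun n => n := ⟨X, fun n => eval_X⟩
  have hadd : ∀ f g, IsPoly f → IsPoly g → IsPoly fun n => f n + g n :=
    fun f g ⟨p, hp⟩ ⟨q, hq⟩ => ⟨p + q, fun n => by rw [eval_add, hp, hq]⟩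
  have hmul : ∀ f g, IsPoly f → IsPoly g → IsPoly fun n => f n * g n :=
    fun f g ⟨p, hp⟩ ⟨q, hq⟩ => ⟨p * q, fun n => by rw [eval_mul, hp, hq]⟩
  change IsPoly fun n => mainTime n
  simp only [mainTime, roundTime, auctionTime, bidTime]
  -- The time bounds use only `n`, constants, sums and products.
  repeat' first
    | exact hid
    | exact hconst _
    | refine hadd _ _ ?_ ?_
    | refine hmul _ _ ?_ ?_

end RAM

/-- One program and one polynomial serve all instances: for every tournament `E` on `n` teams, every
set `M ⊆ E` of manipulable edges and every distinguished team `w`, the program halts within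
polynomially many steps in `n` and reports the minimal number of edges in `M` whose reversal makes
`w` a winner under Copeland scoring (or that no set of reversals does). -/
theorem theorem6 :
    ∃ (P : RAM.Program) (p : Polynomial ℕ),
      ∀ (n : ℕ) (E M : Finset (Fin n × Fin n)) (w : Fin n), IsTournament E → M ⊆ E →
        ∃ (s : RAM.State) (t : ℕ),
          RAM.Exec P (inputState E M w) s t ∧ t ≤ p.eval n ∧
            ReportsMin s (manipulationCounts E M w) := by
  obtain ⟨p, hp⟩ := RAM.exists_polynomial_mainTime
  refine ⟨RAM.main, p, fun n E M w hE hM => ?_⟩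
  rw [hp]
  exact RAM.main_halts hE hM
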